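/- Let $\Gamma\subseteq \mathrm{PSL}_2(\mathbb R)$ be a Fuchsian group such that $\Gamma\backslash\mathbb H$ has finite volume for $d\mu z = dx\,dy/y^2$, let $k\ge 4$ be an even integer, and let $S_k$ be the space of holomorphic weight $k$ cusp forms for $\Gamma$ (no decay condition if $\Gamma$ has no cusps). Write $(f|_k\gamma)(z)=f(\gamma z)/j(\gamma,z)^k$, where $j(\gamma,z)=cz+d$ for $\gamma=\begin{pmatrix}a&b\\c&d\end{pmatrix}$. Let $\eta=\{\eta_1,\eta_2\}\subset\mathbb R\cup\{\infty\}$ be a pair of distinct points that are both fixed by some hyperbolic element of $\Gamma$, let $\Gamma_\eta=\langle\gamma_\eta\rangle\cong\mathbb Z$ be the group of elements of $\Gamma$ fixing $\eta_1$ and $\eta_2$, and let $\sigma_\eta\in \mathrm{SL}_2(\mathbb R)$ and $\xi>1$ be such that $\sigma_\eta 0=\eta_1$, $\sigma_\eta\infty=\eta_2$ and $\sigma_\eta^{-1}\gamma_\eta\sigma_\eta=\pm\begin{pmatrix}\xi&0\\0&\xi^{-1}\end{pmatrix}$. Let $m\in\mathbb Z$ and let $f\in S_k$ have the hyperbolic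 expansion $$(f|_k\sigma_\eta)(w)=\sum_{l\in\mathbb Z} b_\eta(l)\,w^{-k/2+\pi i l/\log\xi}\qquad(w\in\mathbb H)$$ (principal branch of the powers). Then the hyperbolic Poincaré series $$\Phi_{\mathrm{Hyp}}(z,m,\eta)=\sum_{\gamma\in\Gamma_\eta\backslash\Gamma}\frac{(\sigma_\eta^{-1}\gamma z)^{-k/2+\pi i m/\log\xi}}{j(\sigma_\eta^{-1}\gamma,z)^{k}}$$ converges absolutely for every $z\in\mathbb H$, the integral defining the Petersson inner product $\langle f,g\rangle=\int_{\Gamma\backslash\mathbb H} f(z)\overline{g(z)}\,y^k\,d\mu z$ converges absolutely for $g=\Phi_{\mathrm{Hyp}}(\cdot,m,\eta)$, and $$\langle f,\Phi_{\mathrm{Hyp}}(\cdot,m,\eta)\rangle=b_\eta(m)\left[2\log\xi\int_0^\pi e^{-2\pi m\theta/\log\xi}(\sin\theta)^{k-2}\,d\theta\right].$$ Moreover this equals $$b_\eta(m)\cdot\frac{2\log\xi}{(2i)^{k-1}}\left(e^{-2\pi^2m/\log\xi}-1\right)\frac{\Gamma\!\left(\frac{\pi i m}{\log\xi}-\frac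 k2+1\right)\Gamma(k-1)}{\Gamma\!\left(\frac{\pi i m}{\log\xi}+\frac k2\right)}\quad\text{if } m\ne0,$$ where $\Gamma(\cdot)$ denotes the Gamma function, and $$b_\eta(0)\cdot\frac{2\pi\log\xi}{2^{k-2}}\binom{k-2}{k/2-1}\quad\text{if } m=0.$$ -/

import Mathlib

open UpperHalfPlane MeasureTheory
open scoped Matrix MatrixGroups ModularForm

noncomputable section

/-- The transformations of `ℍ` given by the elements of `Γ`. If `Γ` has determinant one this is the
image of `Γ` in `PSL(2, ℝ)`, and it acts faithfully on `ℍ`. -/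
def transformationGroup (Γ : Subgroup (GL (Fin 2) ℝ)) : Subgroup (Equiv.Perm ℍ) :=
  Γ.map (MulAction.toPermHom (GL (Fin 2) ℝ) ℍ)

/-- `{η₁, η₂}` is a hyperbolic pair for `Γ`: two distinct points of `ℝ ∪ {∞}` that are both fixed
by one hyperbolic element of `Γ`. -/
def IsHyperbolicPair (Γ : Subgroup (GL (Fin 2) ℝ)) (η₁ η₂ : OnePoint ℝ) : Prop :=
  η₁ ≠ η₂ ∧ ∃ γ ∈ Γ, γ.val.IsHyperbolic ∧ γ • η₁ = η₁ ∧ γ • η₂ = η₂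

/-- `Γ_η`: the elements of `Γ` that fix both `η₁` and `η₂`. For `η₁ ≠ η₂` and `Γ` of determinant
one, these are the hyperbolic elements fixing both points, together with the elements `±1` of `Γ`,
which are trivial in `PSL(2, ℝ)`. -/
def pairStabilizer (Γ : Subgroup (GL (Fin 2) ℝ)) (η₁ η₂ : OnePoint ℝ) :
    Subgroup (GL (Fin 2) ℝ) :=
  Γ ⊓ MulAction.stabilizer (GL (Fin 2) ℝ) η₁ ⊓ MulAction.stabilizer (GL (Fin 2) ℝ) η₂

/-- `γη` generates `Γ_η` (up to sign), and `σ ∈ SL(2, ℝ)` is a scaling matrix for the pair: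
`σ 0 = η₁`, `σ ∞ = η₂` and `σ⁻¹ γη σ = ± diag(ξ, ξ⁻¹)` with `ξ > 1`. -/
structure IsHyperbolicScaling (Γ : Subgroup (GL (Fin 2) ℝ)) (η₁ η₂ : OnePoint ℝ)
    (γη σ : GL (Fin 2) ℝ) (ξ : ℝ) : Prop where
  mem : γη ∈ pairStabilizer Γ η₁ η₂
  generates : ∀ γ ∈ pairStabilizer Γ η₁ η₂, ∃ n : ℤ, γ = γη ^ n ∨ γ = -γη ^ n
  det_eq_one : σ.det = 1
  smul_zero : σ • ((0 : ℝ) : OnePoint ℝ) = η₁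
  smul_infty : σ • (OnePoint.infty : OnePoint ℝ) = η₂
  one_lt : 1 < ξ
  conj : (σ⁻¹ * γη * σ).val = !![ξ, 0; 0, ξ⁻¹] ∨ (σ⁻¹ * γη * σ).val = -!![ξ, 0; 0, ξ⁻¹]

/-- The function `w ↦ w ^ (-k/2 + π i m / log ξ)` on `ℍ` (principal branch, `0 < arg w < π`). -/
def hyperbolicPower (k : ℕ) (ξ : ℝ) (m : ℤ) (w : ℍ) : ℂ :=
  (w : ℂ) ^ (-(k : ℂ) / 2 + Real.pi * Complex.I * m / Real.log ξ)

/-- `b` is the sequence of coefficients of the hyperbolic expansion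
`(f ∣ₖ σ)(w) = ∑ₘ b(m) w ^ (-k/2 + π i m / log ξ)`, valid for all `w ∈ ℍ`. -/
def IsHyperbolicExpansion (k : ℕ) (σ : GL (Fin 2) ℝ) (ξ : ℝ) (f : ℍ → ℂ) (b : ℤ → ℂ) : Prop :=
  ∀ w : ℍ, HasSum (fun m : ℤ ↦ b m * hyperbolicPower k ξ m w) ((f ∣[(k : ℤ)] σ) w)

/-- The space `Γ₀ \ Γ` of cosets `Γ₀ γ`, `γ ∈ Γ`. -/
abbrev RightCosets (Γ Γ₀ : Subgroup (GL (Fin 2) ℝ)) : Type :=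
  Quotient (QuotientGroup.rightRel (Γ₀.subgroupOf Γ))

/-- The term `(φ ∣ₖ γ)(z)` of the relative Poincaré series belonging to the coset `Γ₀ γ`. It does
not depend on the representative if `φ ∣ₖ γ = φ` for all `γ ∈ Γ₀`. -/
def relPoincareTerm (Γ Γ₀ : Subgroup (GL (Fin 2) ℝ)) (k : ℤ) (φ : ℍ → ℂ)
    (q : RightCosets Γ Γ₀) (z : ℍ) : ℂ :=
  (φ ∣[k] (q.out : GL (Fin 2) ℝ)) z

/-- The relative Poincaré series `P[φ](z) = ∑_{γ ∈ Γ₀ \ Γ} (φ ∣ₖ γ)(z)`. -/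
def relPoincare (Γ Γ₀ : Subgroup (GL (Fin 2) ℝ)) (k : ℤ) (φ : ℍ → ℂ) (z : ℍ) : ℂ :=
  ∑' q : RightCosets Γ Γ₀, relPoincareTerm Γ Γ₀ k φ q z

/-- The function `w ^ (-k/2 + π i m / log ξ) ∣ₖ σ⁻¹` from which the hyperbolic Poincaré series is
built. -/
def hyperbolicSeed (k : ℕ) (σ : GL (Fin 2) ℝ) (ξ : ℝ) (m : ℤ) : ℍ → ℂ :=
  hyperbolicPower k ξ m ∣[(k : ℤ)] σ⁻¹

/-- The hyperbolic power is invariant under the slash action of `± diag(ξ, ξ⁻¹)`. -/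
theorem hyperbolicPower_slash {k : ℕ} (hk : Even k) {ξ : ℝ} (hξ : 1 < ξ) (m : ℤ)
    {δ : GL (Fin 2) ℝ} {ε : ℝ} (hε : ε = 1 ∨ ε = -1)
    (hδ : δ.val = !![ε * ξ, 0; 0, ε * ξ⁻¹]) :
    hyperbolicPower k ξ m ∣[(k : ℤ)] δ = hyperbolicPower k ξ m := by
  have hξ0 : (0 : ℝ) < ξ := by linarith
  have hε2 : ε * ε = 1 := by rcases hε with rfl | rfl <;> norm_num
  have hε0 : ε ≠ 0 := by rintro rfl; norm_num at hε2
  have hlog : Real.log ξ ≠ 0 := (Real.log_pos hξ).ne'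
  have hdet : δ.det.val = 1 := by
    rw [Matrix.GeneralLinearGroup.val_det_apply, hδ, Matrix.det_fin_two_of]
    field_simp
    nlinarith
  have hdet' : 0 < δ.det.val := by rw [hdet]; norm_num
  funext w
  have h00 : δ 0 0 = ε * ξ := by simp [hδ]
  have h01 : δ 0 1 = 0 := by simp [hδ]
  have h10 : δ 1 0 = 0 := by simp [hδ]
  have h11 : δ 1 1 = ε * ξ⁻¹ := by simp [hδ]
  have hden : denom δ w = ((ε * ξ⁻¹ : ℝ) : ℂ) := by simp [denom, h10, h11]
  have hε' : (ε : ℂ) ≠ 0 := by exact_mod_cast hε0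
  have hξ' : (ξ : ℂ) ≠ 0 := by exact_mod_cast hξ0.ne'
  have hcoe : ((δ • w : ℍ) : ℂ) = ((ξ ^ 2 : ℝ) : ℂ) * (w : ℂ) := by
    rw [UpperHalfPlane.coe_smul_of_det_pos hdet', hden]
    simp only [num, h00, h01]
    push_cast
    field_simp
    simp
  have hw : (w : ℂ) ≠ 0 := w.ne_zero
  have hpow : (((ξ ^ 2 : ℝ) : ℂ)) ^
      (-(k : ℂ) / 2 + Real.pi * Complex.I * m / Real.log ξ) = (ξ : ℂ) ^ (-(k : ℤ)) := by
    have hl : Complex.log (((ξ ^ 2 : ℝ) : ℂ)) = 2 * (Real.log ξ : ℂ) := by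
      rw [← Complex.ofReal_log (by positivity), Real.log_pow]; push_cast; ring
    have hlog' : (Real.log ξ : ℂ) ≠ 0 := by exact_mod_cast hlog
    rw [Complex.cpow_def_of_ne_zero (by exact_mod_cast (pow_pos hξ0 2).ne'), hl]
    have : 2 * (Real.log ξ : ℂ) * (-(k : ℂ) / 2 + Real.pi * Complex.I * m / Real.log ξ)
        = Complex.log ξ * ((-(k : ℤ) : ℤ) : ℂ) + m * (2 * Real.pi * Complex.I) := by
      rw [← Complex.ofReal_log hξ0.le]; push_cast; field_simp
    rw [this, Complex.exp_add, Complex.exp_int_mul_two_pi_mul_I, mul_one,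
      ← Complex.cpow_def_of_ne_zero hξ', Complex.cpow_intCast]
  have hεk : (ε : ℂ) ^ k = 1 := by
    rcases hε with rfl | rfl
    · simp
    · simp [hk.neg_one_pow]
  rw [ModularForm.slash_apply]
  simp only [UpperHalfPlane.σ, hdet, hden, zero_lt_one, if_true]
  unfold hyperbolicPower
  have hmul : ∀ s : ℂ, (((ξ ^ 2 : ℝ) : ℂ) * (w : ℂ)) ^ s
      = (((ξ ^ 2 : ℝ) : ℂ)) ^ s * (w : ℂ) ^ s := by
    intro s
    have h2 : (0 : ℝ) < ξ ^ 2 := by positivity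
    have h2' : (((ξ ^ 2 : ℝ) : ℂ)) ≠ 0 := by exact_mod_cast h2.ne'
    rw [Complex.cpow_def_of_ne_zero (mul_ne_zero h2' hw), Complex.cpow_def_of_ne_zero h2',
      Complex.cpow_def_of_ne_zero hw, Complex.log_ofReal_mul h2 hw, ← Complex.ofReal_log h2.le,
      add_mul, Complex.exp_add]
  rw [hcoe, hmul, hpow]
  simp only [ContinuousAlgEquiv.coe_refl', id, abs_one, Complex.ofReal_one, one_zpow, mul_one]
  push_cast
  rw [mul_zpow, zpow_neg, zpow_neg, zpow_neg, zpow_natCast, zpow_natCast, zpow_natCast, hεk,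
    inv_pow, inv_inv]
  have hξk : (ξ : ℂ) ^ k ≠ 0 := pow_ne_zero _ hξ'
  field_simp

theorem slash_neg_of_even {k : ℕ} (hk : Even k) (φ : ℍ → ℂ) (g : GL (Fin 2) ℝ) :
    φ ∣[(k : ℤ)] (-g) = φ ∣[(k : ℤ)] g := by
  funext z
  have hd : denom (-g) z = - denom g z := by simp [denom]; ring
  have hs : (-g) • z = g • z := by simp
  have hdet : (-g).det.val = g.det.val := by
    simp [Matrix.det_neg]
  have hσ : UpperHalfPlane.σ (-g) = UpperHalfPlane.σ g := by
    simp only [UpperHalfPlane.σ, hdet]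
  rw [ModularForm.slash_apply, ModularForm.slash_apply, hd, hs, hdet, hσ]
  have he : Even (-(k : ℤ)) := by simpa using hk
  rw [he.neg_zpow]

/-- The function from which the hyperbolic Poincaré series is built is invariant under `Γ_η`, so
that the terms of the series do not depend on the representatives of the cosets. -/
theorem hyperbolicSeed_slash {Γ : Subgroup (GL (Fin 2) ℝ)} {η₁ η₂ : OnePoint ℝ}
    {γη σ : GL (Fin 2) ℝ} {ξ : ℝ} (h : IsHyperbolicScaling Γ η₁ η₂ γη σ ξ) {k : ℕ}
    (hk : Even k) (m : ℤ) {γ : GL (Fin 2) ℝ} (hγ : γ ∈ pairStabilizer Γ η₁ η₂) :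
    hyperbolicSeed k σ ξ m ∣[(k : ℤ)] γ = hyperbolicSeed k σ ξ m := by
  have key : hyperbolicPower k ξ m ∣[(k : ℤ)] (σ⁻¹ * γη * σ) = hyperbolicPower k ξ m := by
    rcases h.conj with hc | hc
    · exact hyperbolicPower_slash hk h.one_lt m (ε := 1) (Or.inl rfl) (by simpa using hc)
    · exact hyperbolicPower_slash hk h.one_lt m (ε := -1) (Or.inr rfl) (by simpa using hc)
  have h1 : hyperbolicSeed k σ ξ m ∣[(k : ℤ)] γη = hyperbolicSeed k σ ξ m := by
    unfold hyperbolicSeed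
    conv_rhs => rw [← key]
    rw [← SlashAction.slash_mul, ← SlashAction.slash_mul]
    congr 1
    group
  have h2 : hyperbolicSeed k σ ξ m ∣[(k : ℤ)] γη⁻¹ = hyperbolicSeed k σ ξ m := by
    conv_lhs => rw [← h1]
    rw [← SlashAction.slash_mul]; simp
  have h3 : ∀ n : ℤ, hyperbolicSeed k σ ξ m ∣[(k : ℤ)] (γη ^ n) = hyperbolicSeed k σ ξ m := by
    intro n
    induction n using Int.induction_on with
    | zero => simp
    | succ n ih => rw [zpow_add_one, SlashAction.slash_mul, ih, h1]
    | pred n ih => rw [zpow_sub_one, SlashAction.slash_mul, ih, h2]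
  obtain ⟨n, rfl | rfl⟩ := h.generates γ hγ
  · exact h3 n
  · rw [slash_neg_of_even hk, h3 n]

theorem relPoincareTerm_mk {Γ Γ₀ : Subgroup (GL (Fin 2) ℝ)} {k : ℤ} {φ : ℍ → ℂ}
    (hφ : ∀ γ ∈ Γ₀, φ ∣[k] γ = φ) (γ : Γ) (z : ℍ) :
    relPoincareTerm Γ Γ₀ k φ (Quotient.mk _ γ) z = (φ ∣[k] (γ : GL (Fin 2) ℝ)) z := by
  have h : QuotientGroup.rightRel (Γ₀.subgroupOf Γ)
      (Quotient.mk (QuotientGroup.rightRel (Γ₀.subgroupOf Γ)) γ).out γ := Quotient.mk_out γ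
  rw [QuotientGroup.rightRel_apply, Subgroup.mem_subgroupOf] at h
  unfold relPoincareTerm
  have h' := congrArg (fun ψ ↦ ψ ∣[k] ((Quotient.mk (QuotientGroup.rightRel
    (Γ₀.subgroupOf Γ)) γ).out : GL (Fin 2) ℝ)) (hφ _ h)
  rw [← congrFun h' z]
  simp only [← SlashAction.slash_mul]
  simp

/-- The hyperbolic Poincaré series `Φ_Hyp(z, m, η)`. -/
def hyperbolicPoincare (Γ : Subgroup (GL (Fin 2) ℝ)) (η₁ η₂ : OnePoint ℝ) (k : ℕ)
    (σ : GL (Fin 2) ℝ) (ξ : ℝ) (m : ℤ) : ℍ → ℂ :=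
  relPoincare Γ (pairStabilizer Γ η₁ η₂) k (hyperbolicSeed k σ ξ m)

/-- The integrand `f(z) * conj (g(z)) * y ^ k` of the Petersson inner product. -/
def peterssonIntegrand (k : ℕ) (f g : ℍ → ℂ) (z : ℍ) : ℂ :=
  f z * (starRingEnd ℂ) (g z) * (z.im : ℂ) ^ k

/-- The Petersson inner product `⟨f, g⟩`, as an integral over a fundamental domain `D` with respect
to the measure `dx dy / y²`. -/
def peterssonInner (k : ℕ) (D : Set ℍ) (f g : ℍ → ℂ) : ℂ :=
  ∫ z in D, peterssonIntegrand k f g z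

end

open scoped Manifold Topology Pointwise

/-! The formula comes from unfolding. The seed of the series is invariant under `Γ_η`, so the
integral of `f` against the series over `D` becomes the integral of `f` against the seed over a
fundamental domain of `Γ_η`. Moved by `σ`, this domain is the half annulus `1 ≤ |w| < ξ ^ 2`. In the
coordinates `w = exp (t + i θ)` the measure is `dt dθ / sin² θ`, and the `l`-th term of the
expansion contributes the character `exp (π i (l - m) t / log ξ)`, which has period `2 log ξ` in
`t`. Integration over `t` keeps only `l = m`, and the stated integral over `θ` remains. It is
evaluated by the two-step recursion `integral_exp_mul_sin_pow_add_two`, which the Gamma quotient and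
the central binomial expression also satisfy.

Unfolding needs absolute convergence. The weighted seed `‖φ‖ y ^ (k / 2)` is integrable over the
half annulus, because for `k ≥ 4` it is at most a constant times `y ^ 2`, and this cancels the
density of the hyperbolic measure. Unfolding the weighted seed gives convergence of the series
almost everywhere on `D`; a Harnack-type comparison, `exists_norm_hyperbolicPower_le`, carries it to
every point.

The other input is the boundedness of `‖f‖ y ^ (k / 2)`, `exists_bound_of_finite_covolume`. It is
proved from finite covolume without constructing a fundamental domain with cusps. The `deviation` of
`g` at `z` measures how far `g`, seen from `z`, is from a scalar. By a Zassenhaus-type commutator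
estimate, elements of small deviation at `z` commute with one of minimal deviation. Where no
nonscalar element has small deviation (the thick part), a packing argument with finite volume gives
compactness modulo `Γ`. Where the minimal deviation is sufficiently small, the minimal element is
parabolic, and there the vanishing of `f` at its fixed point bounds `f` through the maximum
principle in the variable `q`. -/

noncomputable section

/-! ### Deviation from scalar matrices and the commutator estimate -/

/-- A `2 × 2` matrix that is a multiple of the identity. -/
def IsScalarMatrix (M : Matrix (Fin 2) (Fin 2) ℝ) : Prop :=
  M 0 1 = 0 ∧ M 1 0 = 0 ∧ M 0 0 = M 1 1

/-- The squared Frobenius norm of the traceless part of `s⁻¹ M s`, where `s ∈ SL(2, ℝ)` is such that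
`s • I = z`. -/
def deviation (M : Matrix (Fin 2) (Fin 2) ℝ) (z : ℍ) : ℝ :=
  (M 0 0 - M 1 1 - 2 * M 1 0 * z.re) ^ 2 / 2 +
    ((-M 1 0 * z.re ^ 2 + (M 0 0 - M 1 1) * z.re + M 0 1) / z.im) ^ 2 + (M 1 0 * z.im) ^ 2

/-- The squared Frobenius norm. -/
def frobSq (M : Matrix (Fin 2) (Fin 2) ℝ) : ℝ :=
  M 0 0 ^ 2 + M 0 1 ^ 2 + M 1 0 ^ 2 + M 1 1 ^ 2

theorem deviation_nonneg (M : Matrix (Fin 2) (Fin 2) ℝ) (z : ℍ) : 0 ≤ deviation M z := by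
  unfold deviation; positivity

theorem deviation_pos {M : Matrix (Fin 2) (Fin 2) ℝ} (hM : ¬ IsScalarMatrix M) (z : ℍ) :
    0 < deviation M z := by
  refine (deviation_nonneg M z).lt_of_ne fun h ↦ hM ?_
  have hy := z.im_ne_zero
  unfold deviation at h
  have h1 := sq_nonneg (M 0 0 - M 1 1 - 2 * M 1 0 * z.re)
  have h2 := sq_nonneg ((-M 1 0 * z.re ^ 2 + (M 0 0 - M 1 1) * z.re + M 0 1) / z.im)
  have h3 := sq_nonneg (M 1 0 * z.im)
  have e3 : M 1 0 = 0 := by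
    have : M 1 0 * z.im = 0 := by apply pow_eq_zero_iff two_ne_zero |>.mp; linarith
    simpa [hy] using this
  have e1 : M 0 0 - M 1 1 = 0 := by
    have : M 0 0 - M 1 1 - 2 * M 1 0 * z.re = 0 := by
      apply pow_eq_zero_iff two_ne_zero |>.mp; linarith
    simpa [e3] using this
  have e2 : M 0 1 = 0 := by
    have : (-M 1 0 * z.re ^ 2 + (M 0 0 - M 1 1) * z.re + M 0 1) / z.im = 0 := by
      apply pow_eq_zero_iff two_ne_zero |>.mp; linarith
    simpa [e3, e1, hy] using this
  exact ⟨e2, e3, by linarith⟩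

theorem deviation_eq_zero_of_isScalarMatrix {M : Matrix (Fin 2) (Fin 2) ℝ}
    (hM : IsScalarMatrix M) (z : ℍ) : deviation M z = 0 := by
  obtain ⟨h1, h2, h3⟩ := hM
  simp [deviation, h1, h2, h3]

theorem continuous_deviation (M : Matrix (Fin 2) (Fin 2) ℝ) : Continuous (deviation M) := by
  unfold deviation
  have h1 := continuous_re
  have h2 := continuous_im
  fun_prop (disch := exact fun z ↦ z.im_ne_zero)

/-- The traceless part of a matrix commuting with a nonscalar `A` is a multiple of that of `A`, and
the deviation is a quadratic form in the traceless part. The factor is the same at all points, so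
comparisons can be carried from one point to another. -/
theorem deviation_eq_sq_mul {A B : Matrix (Fin 2) (Fin 2) ℝ} (hA : ¬ IsScalarMatrix A)
    (h : A * B = B * A) : ∃ c : ℝ, ∀ z, deviation B z = c ^ 2 * deviation A z := by
  have e00 := congr_fun₂ h 0 0
  have e01 := congr_fun₂ h 0 1
  have e10 := congr_fun₂ h 1 0
  simp only [Matrix.mul_apply, Fin.sum_univ_two] at e00 e01 e10
  obtain ⟨c, h1, h2, h3⟩ : ∃ c : ℝ, B 0 1 = c * A 0 1 ∧ B 1 0 = c * A 1 0 ∧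
      B 0 0 - B 1 1 = c * (A 0 0 - A 1 1) := by
    by_cases hb : A 0 1 = 0
    · by_cases hc : A 1 0 = 0
      · have hd : A 0 0 - A 1 1 ≠ 0 := fun hd ↦ hA ⟨hb, hc, by linarith⟩
        refine ⟨(B 0 0 - B 1 1) / (A 0 0 - A 1 1), ?_, ?_, by field_simp⟩
        · rw [hb, mul_zero]; apply mul_left_cancel₀ hd; rw [hb] at e01; linarith
        · rw [hc, mul_zero]; apply mul_left_cancel₀ hd; rw [hc] at e10; linarith
      · refine ⟨B 1 0 / A 1 0, ?_, by field_simp, ?_⟩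
        · field_simp; linarith
        · field_simp; linarith
    · refine ⟨B 0 1 / A 0 1, by field_simp, ?_, ?_⟩
      · field_simp; linarith
      · field_simp; linarith
  refine ⟨c, fun z ↦ ?_⟩
  unfold deviation
  rw [h1, h2, h3]
  ring

/-- Both sides are the squared Frobenius norm of `s⁻¹ g s`, where `s • I = z`, split on the right
into traceless and scalar parts. This ties the deviation to displacement. -/
theorem two_mul_cosh_dist_smul {g : GL (Fin 2) ℝ} (hg : g.det = 1) (z : ℍ) :
    2 * Real.cosh (dist z (g • z)) = deviation g.val z + g.val.trace ^ 2 / 2 := by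
  have hd : g.det.val = 1 := by rw [hg]; rfl
  have hdet : g 0 0 * g 1 1 - g 0 1 * g 1 0 = 1 := by
    rw [← Matrix.det_fin_two, ← Matrix.GeneralLinearGroup.val_det_apply, hd]
  have hden := denom_ne_zero g z
  have hN : 0 < Complex.normSq (denom g z) := Complex.normSq_pos.mpr hden
  rw [cosh_dist, im_smul_eq_div_normSq, hd, abs_one, one_mul, dist_comm, dist_eq_norm,
    ← Complex.normSq_eq_norm_sq, coe_smul_of_det_pos (by rw [hd]; norm_num)]
  have hsub : num g z / denom g z - z = (num g z - z * denom g z) / denom g z := by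
    field_simp
  rw [hsub, map_div₀]
  have hy := z.im_ne_zero
  have h1 : 2 * (1 + Complex.normSq (num g z - z * denom g z) / Complex.normSq (denom g z) /
      (2 * z.im * (z.im / Complex.normSq (denom g z)))) =
      2 + Complex.normSq (num g z - z * denom g z) / z.im ^ 2 := by
    field_simp
  rw [h1]
  have h2 : Complex.normSq (num g z - z * denom g z) =
      (-g 1 0 * (z.re ^ 2 - z.im ^ 2) + (g 0 0 - g 1 1) * z.re + g 0 1) ^ 2 +
      (z.im * (g 0 0 - g 1 1 - 2 * g 1 0 * z.re)) ^ 2 := by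
    simp only [num, denom, Complex.normSq_apply, Complex.add_re, Complex.add_im, Complex.sub_re,
      Complex.sub_im, Complex.mul_re, Complex.mul_im, Complex.ofReal_re, Complex.ofReal_im,
      coe_re, coe_im]
    ring
  rw [h2, deviation, Matrix.trace_fin_two]
  field_simp
  linear_combination (-4 * z.im ^ 2) * hdet

theorem dist_smul_smul_of_det_eq_one {g : GL (Fin 2) ℝ} (hg : g.det = 1) (z w : ℍ) :
    dist (g • z) (g • w) = dist z w := by
  have hd : g.val.det = 1 := by
    rw [← Matrix.GeneralLinearGroup.val_det_apply, hg]; rfl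
  set s : SL(2, ℝ) := ⟨g.val, hd⟩ with hs
  have hgs : g = Matrix.SpecialLinearGroup.mapGL ℝ s := Units.ext rfl
  have h : ∀ w : ℍ, g • w = s • w := fun w ↦ by rw [hgs, MulAction.compHom_smul_def]
  rw [h, h, dist_smul]

/-- The displacement and the trace do not change under simultaneous conjugation, and they determine
the deviation. -/
theorem deviation_conj {g t : GL (Fin 2) ℝ} (hg : g.det = 1) (ht : t.det = 1) (z : ℍ) :
    deviation (t * g * t⁻¹).val (t • z) = deviation g.val z := by
  have h1 := two_mul_cosh_dist_smul hg z
  have h2 := two_mul_cosh_dist_smul (g := t * g * t⁻¹) (by simp [hg]) (t • z)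
  have h3 : (t * g * t⁻¹) • t • z = t • g • z := by simp [mul_smul]
  have h4 : (t * g * t⁻¹).val.trace = g.val.trace := by
    rw [Units.val_mul, Units.val_mul, Matrix.trace_units_conj]
  rw [h3, dist_smul_smul_of_det_eq_one ht, h1, h4] at h2
  linarith

/-- For determinant one, `tr² - 4` is the discriminant, an indefinite quadratic form in the
traceless part; the deviation is a definite form that dominates it. -/
theorem abs_trace_sq_sub_four_le {g : GL (Fin 2) ℝ} (hg : g.det = 1) (z : ℍ) :
    |g.val.trace ^ 2 - 4| ≤ 2 * deviation g.val z := by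
  have hdet : g 0 0 * g 1 1 - g 0 1 * g 1 0 = 1 := by
    rw [← Matrix.det_fin_two, ← Matrix.GeneralLinearGroup.val_det_apply, hg]; rfl
  have hy := z.im_ne_zero
  have key : g.val.trace ^ 2 - 4 = (g 0 0 - g 1 1 - 2 * g 1 0 * z.re) ^ 2 +
      4 * (((-g 1 0 * z.re ^ 2 + (g 0 0 - g 1 1) * z.re + g 0 1) / z.im) * (g 1 0 * z.im)) := by
    rw [Matrix.trace_fin_two]
    field_simp
    linear_combination 4 * hdet
  rw [key, deviation, abs_le]
  set p := (-g 1 0 * z.re ^ 2 + (g 0 0 - g 1 1) * z.re + g 0 1) / z.im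
  constructor <;> nlinarith [sq_nonneg (p - g 1 0 * z.im), sq_nonneg (p + g 1 0 * z.im),
    sq_nonneg (g 0 0 - g 1 1 - 2 * g 1 0 * z.re)]

theorem frobSq_nonneg (M : Matrix (Fin 2) (Fin 2) ℝ) : 0 ≤ frobSq M := by
  unfold frobSq; positivity

theorem frobSq_mul_le (M N : Matrix (Fin 2) (Fin 2) ℝ) :
    frobSq (M * N) ≤ frobSq M * frobSq N := by
  simp only [frobSq, Matrix.mul_apply, Fin.sum_univ_two]
  nlinarith [sq_nonneg (M 0 0 * N 1 0 - M 0 1 * N 0 0), sq_nonneg (M 0 0 * N 1 1 - M 0 1 * N 0 1),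
    sq_nonneg (M 1 0 * N 1 0 - M 1 1 * N 0 0), sq_nonneg (M 1 0 * N 1 1 - M 1 1 * N 0 1)]

theorem frobSq_inv {g : GL (Fin 2) ℝ} (hg : g.det = 1) : frobSq (g⁻¹).val = frobSq g.val := by
  have hd : g.val.det = 1 := by
    rw [← Matrix.GeneralLinearGroup.val_det_apply, hg]; rfl
  rw [Matrix.coe_units_inv, Matrix.inv_def, Matrix.adjugate_fin_two, hd]
  simp [frobSq]
  ring

theorem deviation_I (M : Matrix (Fin 2) (Fin 2) ℝ) :
    deviation M I = (M 0 0 - M 1 1) ^ 2 / 2 + M 0 1 ^ 2 + M 1 0 ^ 2 := by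
  simp [deviation]

theorem deviation_I_le_frobSq_sub (M : Matrix (Fin 2) (Fin 2) ℝ) (c : ℝ) :
    deviation M I ≤ frobSq (M - c • 1) := by
  rw [deviation_I]
  simp [frobSq]
  nlinarith [sq_nonneg (M 0 0 - c + (M 1 1 - c))]

theorem frobSq_eq_two_mul_cosh {g : GL (Fin 2) ℝ} (hg : g.det = 1) :
    frobSq g.val = 2 * Real.cosh (dist I (g • I)) := by
  rw [two_mul_cosh_dist_smul hg, deviation_I, Matrix.trace_fin_two, frobSq]
  ring

theorem frobSq_le_of_det_eq_one {g : GL (Fin 2) ℝ} (hg : g.det = 1) :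
    frobSq g.val ≤ 2 + 2 * deviation g.val I := by
  rw [frobSq_eq_two_mul_cosh hg, two_mul_cosh_dist_smul hg]
  have := (abs_le.mp (abs_trace_sq_sub_four_le hg I)).2
  linarith

/-- The commutator only sees the traceless parts, so it is bilinear in them. -/
theorem frobSq_commutator_le (A B : Matrix (Fin 2) (Fin 2) ℝ) :
    frobSq (A * B - B * A) ≤ 4 * (deviation A I * deviation B I) := by
  rw [deviation_I, deviation_I]
  simp only [frobSq, Matrix.sub_apply, Matrix.mul_apply, Fin.sum_univ_two]
  have key : ∀ x y z x' y' z' : ℝ,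
      2 * (y * z' - z * y') ^ 2 + (x * y' - y * x') ^ 2 + (z * x' - x * z') ^ 2 ≤
        4 * ((x ^ 2 / 2 + y ^ 2 + z ^ 2) * (x' ^ 2 / 2 + y' ^ 2 + z' ^ 2)) := by
    intro x y z x' y' z'
    have e1 : (y * z' - z * y') ^ 2 ≤ (y ^ 2 + z ^ 2) * (y' ^ 2 + z' ^ 2) := by
      nlinarith [sq_nonneg (y * y' + z * z')]
    have e2 : (x * y' - y * x') ^ 2 ≤ 2 * (x ^ 2 * y' ^ 2) + 2 * (y ^ 2 * x' ^ 2) := by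
      nlinarith [sq_nonneg (x * y' + y * x')]
    have e3 : (z * x' - x * z') ^ 2 ≤ 2 * (z ^ 2 * x' ^ 2) + 2 * (x ^ 2 * z' ^ 2) := by
      nlinarith [sq_nonneg (z * x' + x * z')]
    have e4 : 0 ≤ (y ^ 2 + z ^ 2) * (y' ^ 2 + z' ^ 2) := by positivity
    have e5 : 0 ≤ x ^ 2 * x' ^ 2 := by positivity
    nlinarith
  have := key (A 0 0 - A 1 1) (A 0 1) (A 1 0) (B 0 0 - B 1 1) (B 0 1) (B 1 0)
  refine le_trans (le_of_eq ?_) this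
  ring

/-- `A B A⁻¹ B⁻¹ - 1 = (A B - B A) A⁻¹ B⁻¹`, and subtracting a scalar matrix does not change the
deviation. -/
theorem deviation_commutator_le_I {A B : GL (Fin 2) ℝ} (hA : A.det = 1) (hB : B.det = 1) :
    deviation (A * B * A⁻¹ * B⁻¹).val I ≤
      4 * (deviation A.val I * deviation B.val I) * (frobSq A.val * frobSq B.val) := by
  have h1 : (A * B * A⁻¹ * B⁻¹).val - (1 : ℝ) • 1 =
      (A.val * B.val - B.val * A.val) * ((A⁻¹).val * (B⁻¹).val) := by
    have e1 : A.val * (A⁻¹).val = 1 := by rw [← Units.val_mul]; simp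
    have e2 : B.val * (B⁻¹).val = 1 := by rw [← Units.val_mul]; simp
    simp only [Units.val_mul, one_smul, sub_mul]
    have : B.val * A.val * ((A⁻¹).val * (B⁻¹).val) = 1 := by
      rw [mul_assoc, ← mul_assoc A.val, e1, one_mul, e2]
    rw [this]
    simp only [mul_assoc]
  refine (deviation_I_le_frobSq_sub _ 1).trans ?_
  rw [h1]
  refine (frobSq_mul_le _ _).trans ?_
  refine mul_le_mul (frobSq_commutator_le _ _) ?_ (frobSq_nonneg _) ?_
  · refine (frobSq_mul_le _ _).trans ?_
    rw [frobSq_inv hA, frobSq_inv hB]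
  · have := deviation_nonneg A.val I
    have := deviation_nonneg B.val I
    positivity

/-- An element of `SL(2, ℝ)` that moves `I` to `z`. -/
theorem exists_smul_I_eq (z : ℍ) : ∃ s : GL (Fin 2) ℝ, s.det = 1 ∧ s • I = z :=
  ⟨Matrix.SpecialLinearGroup.toGL z.toSL2R, by ext; simp, toSL2R_smul_I z⟩

/-- The Zassenhaus phenomenon: near the scalars the commutator is closer to the scalars than either
factor. Conjugation moves `z` to `I`; both Frobenius norms squared are then at most 4, so the bound
is `64 * deviation A * deviation B`, which explains the threshold `1 / 64`. -/
theorem deviation_commutator_lt {A B : GL (Fin 2) ℝ} (hA : A.det = 1) (hB : B.det = 1) {z : ℍ}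
    (hA' : ¬ IsScalarMatrix A.val) (hAz : deviation A.val z ≤ 1)
    (hBz : deviation B.val z < 1 / 64) :
    deviation (A * B * A⁻¹ * B⁻¹).val z < deviation A.val z := by
  obtain ⟨s, hs, rfl⟩ := exists_smul_I_eq z
  have hs' : s⁻¹.det = 1 := by simp [hs]
  have conj : ∀ g : GL (Fin 2) ℝ, g.det = 1 →
      deviation (s⁻¹ * g * s).val I = deviation g.val (s • I) := by
    intro g hg
    have := deviation_conj hg hs' (s • I)
    simpa using this
  have hpos := deviation_pos hA' (s • I)
  have hcomm : s⁻¹ * (A * B * A⁻¹ * B⁻¹) * s =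
      (s⁻¹ * A * s) * (s⁻¹ * B * s) * (s⁻¹ * A * s)⁻¹ * (s⁻¹ * B * s)⁻¹ := by group
  rw [← conj _ (by simp [hA, hB]), hcomm]
  have hA1 : (s⁻¹ * A * s).det = 1 := by simp [hA]
  have hB1 : (s⁻¹ * B * s).det = 1 := by simp [hB]
  refine (deviation_commutator_le_I hA1 hB1).trans_lt ?_
  have hFA := frobSq_le_of_det_eq_one hA1
  have hFB := frobSq_le_of_det_eq_one hB1
  rw [conj A hA] at *
  rw [conj B hB] at *
  have hB0 := deviation_nonneg B.val (s • I)
  have h1 : frobSq (s⁻¹ * A * s).val ≤ 4 := by linarith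
  have h2 : frobSq (s⁻¹ * B * s).val ≤ 4 := by linarith
  have h3 : frobSq (s⁻¹ * A * s).val * frobSq (s⁻¹ * B * s).val ≤ 4 * 4 :=
    mul_le_mul h1 h2 (frobSq_nonneg _) (by norm_num)
  calc _ ≤ 4 * (deviation A.val (s • I) * deviation B.val (s • I)) * (4 * 4) := by gcongr
    _ < deviation A.val (s • I) := by nlinarith

/-! ### Discreteness and elements of minimal deviation -/

section

variable {Γ : Subgroup (GL (Fin 2) ℝ)} [Γ.HasDetOne] [DiscreteTopology Γ]

/-- Proper discontinuity of discrete subgroups of `SL(2, ℝ)`, transferred to `Γ` along `mapGL`. -/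
theorem finite_setOf_mem_smul_inter {K L : Set ℍ} (hK : IsCompact K) (hL : IsCompact L) :
    {γ | γ ∈ Γ ∧ ((fun z ↦ γ • z) '' K ∩ L).Nonempty}.Finite := by
  let Γ' : Subgroup SL(2, ℝ) := Γ.comap (Matrix.SpecialLinearGroup.mapGL ℝ)
  have : DiscreteTopology Γ' := by
    have hc : Continuous (Matrix.SpecialLinearGroup.mapGL ℝ : SL(2, ℝ) →* GL (Fin 2) ℝ) :=
      Matrix.SpecialLinearGroup.continuous_mapGL
    refine DiscreteTopology.of_continuous_injective (β := Γ)
      (f := fun s ↦ ⟨Matrix.SpecialLinearGroup.mapGL ℝ s.1, s.2⟩)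
      ((hc.comp continuous_subtype_val).subtype_mk _) ?_
    intro s t hst
    exact Subtype.ext (Matrix.SpecialLinearGroup.mapGL_injective (congrArg Subtype.val hst))
  have h : ProperlyDiscontinuousSMul Γ' ℍ := inferInstance
  rw [Subgroup.properlyDiscontinuousSMul_iff] at h
  refine ((h hK hL).image (Matrix.SpecialLinearGroup.mapGL ℝ)).subset ?_
  rintro γ ⟨hγ, hne⟩
  have hd : γ.val.det = 1 := by
    rw [← Matrix.GeneralLinearGroup.val_det_apply, Subgroup.HasDetOne.det_eq hγ]; rfl
  have hγ' : Matrix.SpecialLinearGroup.mapGL ℝ (⟨γ.val, hd⟩ : SL(2, ℝ)) = γ := Units.ext rfl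
  refine ⟨⟨γ.val, hd⟩, ⟨?_, ?_⟩, hγ'⟩
  · change _ ∈ Γ
    rwa [hγ']
  · obtain ⟨_, ⟨z, hz, rfl⟩, hzL⟩ := hne
    refine ⟨_, ⟨z, hz, rfl⟩, ?_⟩
    exact hzL

theorem finite_setOf_dist_smul_le (z : ℍ) (r : ℝ) : {γ | γ ∈ Γ ∧ dist z (γ • z) ≤ r}.Finite := by
  refine (finite_setOf_mem_smul_inter (Γ := Γ) (isCompact_singleton (x := z))
    (isCompact_closedBall z r)).subset ?_
  rintro γ ⟨hγ, h⟩
  exact ⟨hγ, γ • z, ⟨z, rfl, rfl⟩, by simpa [dist_comm] using h⟩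

instance countable_of_discrete : Countable Γ := by
  have : (Γ : Set (GL (Fin 2) ℝ)) = ⋃ n : ℕ, {γ | γ ∈ Γ ∧ dist I (γ • I) ≤ n} := by
    ext γ
    simp only [SetLike.mem_coe, Set.mem_iUnion, Set.mem_ofPred_eq, exists_and_left]
    exact ⟨fun h ↦ ⟨h, exists_nat_ge _⟩, fun h ↦ h.1⟩
  have h : (Γ : Set (GL (Fin 2) ℝ)).Countable := by
    rw [this]
    exact Set.countable_iUnion fun n ↦ (finite_setOf_dist_smul_le I n).countable
  exact h.to_subtype

theorem dist_smul_le_of_deviation_le {g : GL (Fin 2) ℝ} (hg : g.det = 1) {z : ℍ} {r : ℝ}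
    (h : deviation g.val z ≤ r) : dist z (g • z) ≤ 2 + 2 * r := by
  have h1 := two_mul_cosh_dist_smul hg z
  have h2 := (abs_le.mp (abs_trace_sq_sub_four_le hg z)).2
  have h3 : Real.exp (dist z (g • z)) ≤ 2 * Real.cosh (dist z (g • z)) := by
    rw [Real.cosh_eq]; have := Real.exp_pos (-dist z (g • z)); linarith
  have h4 := Real.add_one_le_exp (dist z (g • z))
  linarith

theorem finite_setOf_deviation_le (z : ℍ) (r : ℝ) : {γ | γ ∈ Γ ∧ deviation γ.val z ≤ r}.Finite :=
  (finite_setOf_dist_smul_le (Γ := Γ) z (2 + 2 * r)).subset fun _ h ↦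
    ⟨h.1, dist_smul_le_of_deviation_le (Subgroup.HasDetOne.det_eq h.1) h.2⟩

/-- `A` is a nonscalar element of `Γ` of minimal deviation at `z`. -/
structure IsMinimalAt (Γ : Subgroup (GL (Fin 2) ℝ)) (A : GL (Fin 2) ℝ) (z : ℍ) : Prop where
  mem : A ∈ Γ
  nonscalar : ¬ IsScalarMatrix A.val
  le : ∀ B ∈ Γ, ¬ IsScalarMatrix B.val → deviation A.val z ≤ deviation B.val z

/-- Small deviation means small displacement, so by discreteness each sublevel set of the deviation
meets `Γ` in a finite set. -/
theorem exists_isMinimalAt (hΓ : ∃ B ∈ Γ, ¬ IsScalarMatrix B.val) (z : ℍ) :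
    ∃ A, IsMinimalAt Γ A z := by
  obtain ⟨B, hB, hB'⟩ := hΓ
  let S := {γ | γ ∈ Γ ∧ deviation γ.val z ≤ deviation B.val z} ∩ {γ | ¬ IsScalarMatrix γ.val}
  have hS : S.Finite := (finite_setOf_deviation_le (Γ := Γ) z _).inter_of_left _
  obtain ⟨A, ⟨⟨hA1, hA2⟩, hA3⟩, hA⟩ :=
    hS.exists_minimalFor (fun γ ↦ deviation γ.val z) S ⟨B, ⟨hB, le_rfl⟩, hB'⟩
  refine ⟨A, hA1, hA3, fun C hC hC' ↦ ?_⟩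
  by_contra! hlt
  exact hlt.not_ge (hA ⟨⟨hC, hlt.le.trans hA2⟩, hC'⟩ hlt.le)

omit [DiscreteTopology Γ] in
-- The commutator has smaller deviation than the minimal element, so it is scalar, equal to `±1`.
theorem IsMinimalAt.mul_comm {A : GL (Fin 2) ℝ} {z : ℍ} (hA : IsMinimalAt Γ A z)
    (hAz : deviation A.val z < 1 / 64) {B : GL (Fin 2) ℝ} (hB : B ∈ Γ)
    (hBz : deviation B.val z < 1 / 64) : A * B = B * A := by
  have dA := Subgroup.HasDetOne.det_eq hA.mem
  have dB := Subgroup.HasDetOne.det_eq hB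
  have hlt := deviation_commutator_lt dA dB hA.nonscalar (by linarith) hBz
  have hmem : A * B * A⁻¹ * B⁻¹ ∈ Γ :=
    Γ.mul_mem (Γ.mul_mem (Γ.mul_mem hA.mem hB) (Γ.inv_mem hA.mem)) (Γ.inv_mem hB)
  have hsc : IsScalarMatrix (A * B * A⁻¹ * B⁻¹).val := by
    by_contra h
    exact hlt.not_ge (hA.le _ hmem h)
  obtain ⟨h1, h2, h3⟩ := hsc
  set c := (A * B * A⁻¹ * B⁻¹).val 0 0 with hc
  have hC : (A * B * A⁻¹ * B⁻¹).val = c • (1 : Matrix (Fin 2) (Fin 2) ℝ) := by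
    ext i j
    fin_cases i <;> fin_cases j <;> simp [h1, h2, ← h3, hc]
  have hcomm : A.val * B.val = c • (B.val * A.val) := by
    have : A * B = (A * B * A⁻¹ * B⁻¹) * (B * A) := by group
    have := congrArg Units.val this
    rw [Units.val_mul, Units.val_mul (A * B * A⁻¹ * B⁻¹), hC, Units.val_mul] at this
    simpa using this
  have hc2 : c ^ 2 = 1 := by
    have := congrArg Matrix.det hC
    rw [← Matrix.GeneralLinearGroup.val_det_apply, Subgroup.HasDetOne.det_eq hmem] at this
    simpa using this.symm
  rcases mul_self_eq_one_iff.mp ((sq c).symm.trans hc2) with h | h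
  · exact Units.ext (by simpa [h] using hcomm)
  -- If the commutator is `-1`, then `A` is conjugate to `-A` and has trace 0, so `|tr² - 4| = 4`,
  -- too large for an element of small deviation.
  · exfalso
    have ht : A.val.trace = 0 := by
      have e1 : A.val = -(B.val * A.val * (B⁻¹).val) := by
        have : A.val * B.val * (B⁻¹).val = A.val := by
          rw [mul_assoc, ← Units.val_mul]; simp
        rw [hcomm, h, neg_one_smul, neg_mul] at this
        exact this.symm
      have e2 := congrArg Matrix.trace e1
      rw [Matrix.trace_neg, Matrix.trace_units_conj] at e2
      linarith
    have := abs_trace_sq_sub_four_le dA z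
    rw [ht] at this
    norm_num at this
    linarith

/-- An element `A'` minimal at `z'` commutes with `A`, so its deviation is `c ^ 2` times that of `A`
at every point. Minimality of `A` at `z` forces `c ^ 2 ≥ 1`, and then `A` is also minimal at `z'`.
-/
theorem IsMinimalAt.of_deviation_lt {A : GL (Fin 2) ℝ} {z z' : ℍ} (hA : IsMinimalAt Γ A z)
    (hAz' : deviation A.val z' < 1 / 64) : IsMinimalAt Γ A z' := by
  obtain ⟨A', hA'⟩ := exists_isMinimalAt (Γ := Γ) ⟨A, hA.mem, hA.nonscalar⟩ z'
  have hle := hA'.le A hA.mem hA.nonscalar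
  have hcomm := hA'.mul_comm (hle.trans_lt hAz') hA.mem hAz'
  obtain ⟨c, hc⟩ := deviation_eq_sq_mul (A := A.val) (B := A'.val) hA.nonscalar (by
    rw [← Units.val_mul, ← Units.val_mul, hcomm])
  have h1 := hA.le A' hA'.mem hA'.nonscalar
  rw [hc z] at h1
  have hpos := deviation_pos hA.nonscalar z
  have hc1 : 1 ≤ c ^ 2 := by
    by_contra! hlt
    nlinarith
  refine ⟨hA.mem, hA.nonscalar, fun B hB hB' ↦ le_trans ?_ (hA'.le B hB hB')⟩
  rw [hc z']
  exact le_mul_of_one_le_left (deviation_nonneg _ _) hc1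

/-- The deviation tends to infinity near a real point that the matrix does not fix, so the
intermediate value theorem applies. -/
theorem exists_deviation_eq {M : Matrix (Fin 2) (Fin 2) ℝ} (hM : ¬ IsScalarMatrix M) {z : ℍ} {r : ℝ}
    (h : deviation M z ≤ r) : ∃ z', deviation M z' = r := by
  obtain ⟨x, hx⟩ : ∃ x : ℝ, -M 1 0 * x ^ 2 + (M 0 0 - M 1 1) * x + M 0 1 ≠ 0 := by
    by_contra! hall
    have h0 := hall 0
    have h1 := hall 1
    have h2 := hall (-1)
    exact hM ⟨by linarith, by linarith, by linarith⟩
  set q := -M 1 0 * x ^ 2 + (M 0 0 - M 1 1) * x + M 0 1 with hq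
  have hr : 0 ≤ r := (deviation_nonneg M z).trans h
  -- At this height above `x` the middle term of the deviation is exactly `(r + 1) ^ 2`, which
  -- exceeds `r`.
  have hy : 0 < |q| / (r + 1) := by positivity
  let w : ℍ := ⟨⟨x, |q| / (r + 1)⟩, hy⟩
  have hw : r ≤ deviation M w := by
    have e : deviation M w = (M 0 0 - M 1 1 - 2 * M 1 0 * x) ^ 2 / 2 +
      (q / (|q| / (r + 1))) ^ 2 + (M 1 0 * (|q| / (r + 1))) ^ 2 := rfl
    have e2 : (q / (|q| / (r + 1))) ^ 2 = (r + 1) ^ 2 := by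
      have : |q| ≠ 0 := abs_ne_zero.mpr hx
      rw [div_pow, div_pow, sq_abs]
      field_simp
    rw [e, e2]
    nlinarith [sq_nonneg (M 0 0 - M 1 1 - 2 * M 1 0 * x), sq_nonneg (M 1 0 * (|q| / (r + 1)))]
  obtain ⟨z', hz'⟩ := mem_range_of_exists_le_of_exists_ge (continuous_deviation M) ⟨z, h⟩ ⟨w, hw⟩
  exact ⟨z', hz'⟩

end

/-! ### The transformation group and compactness of the thick part modulo `Γ` -/

section

variable {Γ : Subgroup (GL (Fin 2) ℝ)}

/-- The transformation of `ℍ` given by an element of `Γ`. -/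
def toTransformation (Γ : Subgroup (GL (Fin 2) ℝ)) (γ : Γ) : transformationGroup Γ :=
  ⟨MulAction.toPermHom (GL (Fin 2) ℝ) ℍ γ, γ, γ.2, rfl⟩

@[simp]
theorem toTransformation_smul (γ : Γ) (z : ℍ) : toTransformation Γ γ • z = (γ : GL (Fin 2) ℝ) • z :=
  rfl

theorem toTransformation_surjective : Function.Surjective (toTransformation Γ) := by
  rintro ⟨_, γ, hγ, rfl⟩
  exact ⟨⟨γ, hγ⟩, rfl⟩

theorem exists_smul_eq (g : transformationGroup Γ) :
    ∃ γ ∈ Γ, ∀ z : ℍ, g • z = γ • z := by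
  obtain ⟨γ, rfl⟩ := toTransformation_surjective g
  exact ⟨γ, γ.2, fun _ ↦ rfl⟩

theorem transformation_ext {g h : transformationGroup Γ} (H : ∀ z : ℍ, g • z = h • z) : g = h :=
  Subtype.ext (Equiv.ext H)

instance countable_transformationGroup [Γ.HasDetOne] [DiscreteTopology Γ] :
    Countable (transformationGroup Γ) :=
  (toTransformation_surjective (Γ := Γ)).countable

instance : ContinuousConstSMul (transformationGroup Γ) ℍ where
  continuous_const_smul g := by
    obtain ⟨γ, -, h⟩ := exists_smul_eq g
    simp only [h]
    exact continuous_const_smul γ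

instance : MeasurableConstSMul (transformationGroup Γ) ℍ where
  measurable_const_smul g := (continuous_const_smul g).measurable

instance : SMulInvariantMeasure (transformationGroup Γ) ℍ volume where
  measure_preimage_smul g s hs := by
    obtain ⟨γ, -, h⟩ := exists_smul_eq g
    simp only [h]
    exact measure_preimage_smul_of_nullMeasurableSet hs.nullMeasurableSet γ

theorem smul_eq_of_isScalarMatrix {g : GL (Fin 2) ℝ} (hg : g.det = 1)
    (h : IsScalarMatrix g.val) (z : ℍ) : g • z = z := by
  have h1 := two_mul_cosh_dist_smul hg z
  have h2 := abs_trace_sq_sub_four_le hg z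
  rw [deviation_eq_zero_of_isScalarMatrix h] at h1 h2
  have h3 : g.val.trace ^ 2 = 4 := by
    rw [mul_zero] at h2
    have := abs_nonpos_iff.mp h2
    linarith
  rw [h3] at h1
  have h4 : Real.cosh (dist z (g • z)) = 1 := by linarith
  by_contra hne
  have h5 := Real.one_lt_cosh.mpr (dist_ne_zero.mpr (Ne.symm hne))
  linarith

theorem isometry_transformation_smul [Γ.HasDetOne] (g : transformationGroup Γ) (z w : ℍ) :
    dist (g • z) (g • w) = dist z w := by
  obtain ⟨γ, hγ, h⟩ := exists_smul_eq g
  rw [h, h, dist_smul_smul_of_det_eq_one (Subgroup.HasDetOne.det_eq hγ)]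

/-- The points at which all nonscalar elements of `Γ` have deviation at least `ε`. -/
def thickPart (Γ : Subgroup (GL (Fin 2) ℝ)) (ε : ℝ) : Set ℍ :=
  {z | ∀ B ∈ Γ, ¬ IsScalarMatrix B.val → ε ≤ deviation B.val z}

theorem IsMinimalAt.mem_thickPart {A : GL (Fin 2) ℝ} {z : ℍ} (hA : IsMinimalAt Γ A z) {ε : ℝ}
    (h : ε ≤ deviation A.val z) : z ∈ thickPart Γ ε :=
  fun B hB hB' ↦ h.trans (hA.le B hB hB')

theorem frobSq_le_of_abs_le {M : Matrix (Fin 2) (Fin 2) ℝ} {r : ℝ} (h : ∀ i j, |M i j| ≤ r) :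
    frobSq M ≤ 4 * r ^ 2 := by
  have h' : ∀ i j, M i j ^ 2 ≤ r ^ 2 := fun i j ↦ sq_le_sq' (abs_le.mp (h i j)).1 (abs_le.mp (h i j)).2
  unfold frobSq
  linarith [h' 0 0, h' 0 1, h' 1 0, h' 1 1]

theorem abs_le_of_frobSq_le {M : Matrix (Fin 2) (Fin 2) ℝ} {r : ℝ} (hr : 0 ≤ r)
    (h : frobSq M ≤ r ^ 2) (i j : Fin 2) : |M i j| ≤ r := by
  apply abs_le_of_sq_le_sq _ hr
  unfold frobSq at h
  have h00 := sq_nonneg (M 0 0)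
  have h01 := sq_nonneg (M 0 1)
  have h10 := sq_nonneg (M 1 0)
  have h11 := sq_nonneg (M 1 1)
  fin_cases i <;> fin_cases j <;> simp <;> linarith

/-- At the points of the thick part, boundedly many transformations have displacement at most
`r`. -/
theorem exists_card_le_of_mem_thickPart [Γ.HasDetOne] {ε : ℝ} (hε : 0 < ε) (r : ℝ) :
    ∃ N : ℕ, ∀ z ∈ thickPart Γ ε, ∀ s : Finset (transformationGroup Γ),
      (∀ g ∈ s, dist z (g • z) ≤ r) → s.card ≤ N := by
  set R := 2 * Real.cosh r with hR
  have hR1 : 2 ≤ R := by have := Real.one_le_cosh r; linarith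
  -- Chosen so that two matrices in the same `δ`-ball have quotient of deviation at most `R * 4 * (2
  -- δ) ^ 2 = ε / 2 < ε`.
  set δ := √(ε / (32 * R)) with hδ
  have hδ0 : 0 < δ := Real.sqrt_pos.mpr (by positivity)
  have hδ2 : δ ^ 2 = ε / (32 * R) := Real.sq_sqrt (by positivity)
  obtain ⟨t, -, htfin, ht⟩ := (isCompact_closedBall (0 : Fin 2 → Fin 2 → ℝ) R).finite_cover_balls hδ0
  refine ⟨htfin.toFinset.card, fun z hz s hs ↦ ?_⟩
  obtain ⟨σ, hσ, hσz⟩ := exists_smul_I_eq z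
  choose γ hγ hγs using fun g : transformationGroup Γ ↦ exists_smul_eq g
  have dγ : ∀ g, (γ g).det = 1 := fun g ↦ Subgroup.HasDetOne.det_eq (hγ g)
  let M : transformationGroup Γ → GL (Fin 2) ℝ := fun g ↦ σ⁻¹ * γ g * σ
  have dM : ∀ g, (M g).det = 1 := fun g ↦ by simp [M, dγ]
  let E : transformationGroup Γ → Fin 2 → Fin 2 → ℝ := fun g i j ↦ (M g).val i j
  have hM : ∀ g ∈ s, frobSq (M g).val ≤ R := by
    intro g hg
    rw [frobSq_eq_two_mul_cosh (dM g)]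
    have : dist I (M g • I) = dist z (g • z) := by
      rw [← dist_smul_smul_of_det_eq_one hσ, hγs, ← hσz]
      simp [M, mul_smul]
    rw [this]
    have h1 : Real.cosh (dist z (g • z)) ≤ Real.cosh r := by
      rw [Real.cosh_le_cosh, abs_of_nonneg dist_nonneg]
      exact (hs g hg).trans (le_abs_self r)
    linarith
  have hcov : ∀ g ∈ s, ∃ x ∈ t, dist (E g) x < δ := by
    intro g hg
    have hmem : (E g) ∈ Metric.closedBall (0 : Fin 2 → Fin 2 → ℝ) R := by
      rw [mem_closedBall_zero_iff, pi_norm_le_iff_of_nonneg (by linarith)]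
      intro i
      rw [pi_norm_le_iff_of_nonneg (by linarith)]
      intro j
      exact abs_le_of_frobSq_le (by linarith) ((hM g hg).trans (by nlinarith)) i j
    simpa using ht hmem
  choose! x hxt hx using hcov
  -- Pigeonhole: two matrices share a ball, their quotient is nonscalar because the transformations
  -- differ, and its deviation contradicts thickness.
  by_contra! hcard
  obtain ⟨g, hg, g', hg', hne, heq⟩ := Finset.exists_ne_map_eq_of_card_lt_of_maps_to hcard
    (f := x) (fun g hg ↦ by simpa using hxt g hg)
  have hclose : ∀ i j, |((M g').val - (M g).val) i j| ≤ 2 * δ := by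
    intro i j
    have h1 : dist (E g') (E g) ≤ 2 * δ := by
      have e1 := hx g hg
      have e2 := hx g' hg'
      rw [heq] at e1
      have := dist_triangle_right (E g')
        (E g) (x g')
      linarith
    have h2 := (dist_le_pi_dist (E g' i) (E g i) j).trans
      ((dist_le_pi_dist (E g') (E g) i).trans h1)
    rwa [Real.dist_eq] at h2
  have hF := frobSq_le_of_abs_le hclose
  have hmem : (γ g)⁻¹ * γ g' ∈ Γ := Γ.mul_mem (Γ.inv_mem (hγ g)) (hγ g')
  have hns : ¬ IsScalarMatrix ((γ g)⁻¹ * γ g').val := by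
    intro hsc
    refine hne (transformation_ext fun w ↦ ?_)
    have := smul_eq_of_isScalarMatrix (Subgroup.HasDetOne.det_eq hmem) hsc w
    rw [mul_smul, inv_smul_eq_iff] at this
    rw [hγs, hγs, this]
  have hdev := hz _ hmem hns
  have hdev' : deviation ((γ g)⁻¹ * γ g').val z = deviation ((M g)⁻¹ * M g').val I := by
    have h := deviation_conj (g := (γ g)⁻¹ * γ g') (t := σ⁻¹)
      (Subgroup.HasDetOne.det_eq hmem) (by simp [hσ]) z
    rw [← h, ← hσz, inv_smul_smul]
    congr 2
    simp only [M]
    group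
  have hfinal : deviation ((M g)⁻¹ * M g').val I ≤ R * (4 * (2 * δ) ^ 2) := by
    refine (deviation_I_le_frobSq_sub _ 1).trans ?_
    have e : ((M g)⁻¹ * M g').val - (1 : ℝ) • 1 = ((M g)⁻¹).val * ((M g').val - (M g).val) := by
      have e1 : ((M g)⁻¹).val * (M g).val = 1 := by rw [← Units.val_mul]; simp
      rw [mul_sub, e1, Units.val_mul, one_smul]
    rw [e]
    refine (frobSq_mul_le _ _).trans ?_
    rw [frobSq_inv (dM g)]
    exact mul_le_mul (hM g hg) hF (frobSq_nonneg _) (by linarith)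
  rw [hdev'] at hdev
  have : R * (4 * (2 * δ) ^ 2) = ε / 2 := by
    rw [mul_pow, hδ2]; field_simp; norm_num
  linarith

theorem volume_ball_eq (z : ℍ) (r : ℝ) :
    volume (Metric.ball z r) = volume (Metric.ball (I : ℍ) r) := by
  obtain ⟨σ, hσ, rfl⟩ := exists_smul_I_eq z
  rw [← measure_preimage_smul_of_nullMeasurableSet (μ := volume)
    (Metric.isOpen_ball (x := σ • (I : ℍ)) (ε := r)).measurableSet.nullMeasurableSet σ]
  congr 1
  ext w
  simp [dist_smul_smul_of_det_eq_one hσ]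

theorem volume_ball_pos (z : ℍ) {r : ℝ} (hr : 0 < r) : 0 < volume (Metric.ball z r) := by
  rw [volume_eq_lintegral, image_coe_ball]
  have hball : 0 < volume (Metric.ball (z.center r : ℂ) (z.im * Real.sinh r)) :=
    Metric.measure_ball_pos _ _ (mul_pos z.im_pos (Real.sinh_pos_iff.mpr hr))
  rw [setLIntegral_pos_iff (by fun_prop)]
  refine hball.trans_le (measure_mono fun w hw ↦ ⟨?_, hw⟩)
  have : w ∈ UpperHalfPlane.coe '' Metric.ball z r := by rwa [image_coe_ball]
  obtain ⟨w', -, rfl⟩ := this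
  simp [w'.im_ne_zero]

/-- Modulo `Γ`, the thick part is contained in a compact set if `Γ` has finite covolume. -/
theorem exists_isCompact_of_thickPart [Γ.HasDetOne] [DiscreteTopology Γ] {D : Set ℍ}
    (hD : IsFundamentalDomain (transformationGroup Γ) D) (hV : volume D < ⊤) {ε : ℝ} (hε : 0 < ε) :
    ∃ K : Set ℍ, IsCompact K ∧ ∀ z ∈ thickPart Γ ε, ∃ γ ∈ Γ, γ • z ∈ K := by
  obtain ⟨N, hN⟩ := exists_card_le_of_mem_thickPart (Γ := Γ) hε 2
  set v := volume (Metric.ball (I : ℍ) 1) with hv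
  have hv0 : 0 < v := volume_ball_pos _ one_pos
  -- Finite sets of thick points whose orbits are pairwise at distance at least 2. Each unit ball,
  -- folded into `D`, covers a point at most `N` times, and balls around different points of `P` do
  -- not meet after folding; hence the volume of `D` bounds the size of `P`.
  let Sep : Finset ℍ → Prop := fun P ↦ (∀ p ∈ P, p ∈ thickPart Γ ε) ∧
    ∀ p ∈ P, ∀ q ∈ P, p ≠ q → ∀ g : transformationGroup Γ, 2 ≤ dist p (g • q)
  have hbound : ∀ P, Sep P → P.card * v ≤ N * volume D := by
    intro P hP
    have h1 : ∀ p, v = ∑' g : transformationGroup Γ, ∫⁻ w in D,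
        (Metric.ball p 1).indicator 1 (g • w) := by
      intro p
      have hm : MeasurableSet (Metric.ball p (1 : ℝ)) := Metric.isOpen_ball.measurableSet
      rw [hv, ← volume_ball_eq p, ← lintegral_indicator_one hm, hD.lintegral_eq_tsum'']
    calc P.card * v = ∑ p ∈ P, ∑' g : transformationGroup Γ, ∫⁻ w in D,
        (Metric.ball p 1).indicator 1 (g • w) := by
          rw [Finset.sum_congr rfl fun p _ ↦ (h1 p).symm]; simp
      _ = ∫⁻ w in D, ∑ p ∈ P, ∑' g : transformationGroup Γ,
          (Metric.ball p 1).indicator 1 (g • w) := by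
        have hm : ∀ p : ℍ, ∀ g : transformationGroup Γ,
            Measurable fun w ↦ (Metric.ball p 1).indicator (1 : ℍ → ENNReal) (g • w) :=
          fun p g ↦ (measurable_one.indicator Metric.isOpen_ball.measurableSet).comp
            (measurable_const_smul g)
        rw [lintegral_finsetSum _ fun p _ ↦ Measurable.tsum (hm p)]
        exact Finset.sum_congr rfl fun p _ ↦
          (lintegral_tsum fun g ↦ (hm p g).aemeasurable).symm
      _ ≤ ∫⁻ w in D, N := by
        refine lintegral_mono fun w ↦ ?_
        by_cases hw : ∃ p ∈ P, ∃ g : transformationGroup Γ, g • w ∈ Metric.ball p 1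
        · obtain ⟨p, hp, g₀, hg₀⟩ := hw
          have htri : ∀ q, ∀ g : transformationGroup Γ, g • w ∈ Metric.ball q 1 →
              dist q ((g * g₀⁻¹) • p) < 2 := by
            intro q g hg
            have e : dist (g • w) ((g * g₀⁻¹) • p) = dist (g₀ • w) p := by
              rw [← isometry_transformation_smul (g * g₀⁻¹) (g₀ • w), mul_smul, mul_smul, inv_smul_smul]
            have := dist_triangle q (g • w) ((g * g₀⁻¹) • p)
            rw [e] at this
            rw [Metric.mem_ball] at hg hg₀
            rw [dist_comm] at hg
            linarith
          -- Only the one point `p` contributes at `w`. If `g` and `g₀` both bring `w` within 1 of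
          -- `p`, then `g * g₀⁻¹` displaces `p` by less than 2, so there are at most `N` such `g`.
          rw [Finset.sum_eq_single_of_mem p hp]
          · classical
            rw [ENNReal.tsum_eq_iSup_sum]
            refine iSup_le fun s ↦ ?_
            have hsum : ∑ g ∈ s, (Metric.ball p 1).indicator (1 : ℍ → ENNReal) (g • w) =
                ((s.filter fun g ↦ g • w ∈ Metric.ball p 1).card : ENNReal) := by
              simp [Set.indicator_apply]
            rw [hsum]
            have := hN p (hP.1 p hp) ((s.filter fun g ↦ g • w ∈ Metric.ball p 1).image
              (· * g₀⁻¹)) (by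
                intro g hg
                obtain ⟨g', hg', rfl⟩ := Finset.mem_image.mp hg
                exact (htri p g' (Finset.mem_filter.mp hg').2).le)
            rw [Finset.card_image_of_injective _ (mul_left_injective _)] at this
            exact_mod_cast this
          · intro q hq hqp
            refine ENNReal.tsum_eq_zero.mpr fun g ↦ Set.indicator_of_notMem (fun hg ↦ ?_) _
            exact (htri q g hg).not_ge (hP.2 q hq p hp hqp _)
        · push Not at hw
          rw [Finset.sum_eq_zero fun p hp ↦ ENNReal.tsum_eq_zero.mpr fun g ↦
            Set.indicator_of_notMem (hw p hp g) _]
          exact zero_le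
      _ = N * volume D := by simp
  have hmax : ∃ P, Sep P ∧ ∀ Q, Sep Q → Q.card ≤ P.card := by
    have hne : {n | ∃ P, Sep P ∧ P.card = n}.Nonempty := ⟨0, ∅, ⟨by simp, by simp⟩, rfl⟩
    have hbdd : BddAbove {n | ∃ P, Sep P ∧ P.card = n} := by
      have hfin : N * volume D / v ≠ ⊤ :=
        ENNReal.div_ne_top (ENNReal.mul_ne_top (by simp) hV.ne) hv0.ne'
      obtain ⟨n, hn⟩ := ENNReal.exists_nat_gt hfin
      refine ⟨n, ?_⟩
      rintro _ ⟨P, hP, rfl⟩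
      have h1 : (P.card : ENNReal) ≤ N * volume D / v := by
        rw [ENNReal.le_div_iff_mul_le (Or.inl hv0.ne') (Or.inr (ENNReal.mul_ne_top (by simp) hV.ne))]
        exact hbound P hP
      exact_mod_cast (h1.trans hn.le)
    obtain ⟨P, hP, hcard⟩ := Nat.sSup_mem hne hbdd
    exact ⟨P, hP, fun Q hQ ↦ hcard ▸ le_csSup hbdd ⟨Q, hQ, rfl⟩⟩
  obtain ⟨P, hP, hPmax⟩ := hmax
  refine ⟨⋃ p ∈ P, Metric.closedBall p 2, P.isCompact_biUnion fun p _ ↦ isCompact_closedBall p 2,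
    fun z hz ↦ ?_⟩
  -- A thick point whose orbit avoids all the closed balls of radius 2 could be added to the maximal
  -- set `P`.
  by_contra! hout
  have hfar : ∀ p ∈ P, ∀ g : transformationGroup Γ, 2 < dist p (g • z) := by
    intro p hp g
    obtain ⟨γ, hγ, h⟩ := exists_smul_eq g
    by_contra! hle
    refine hout γ hγ (Set.mem_iUnion₂.mpr ⟨p, hp, ?_⟩)
    rwa [Metric.mem_closedBall, dist_comm, ← h]
  have hzP : z ∉ P := fun h ↦ by
    have := hfar z h 1
    simp at this
    linarith
  classical
  have hSep : Sep (insert z P) := by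
    refine ⟨fun p hp ↦ ?_, fun p hp q hq hpq g ↦ ?_⟩
    · rcases Finset.mem_insert.mp hp with rfl | hp
      · exact hz
      · exact hP.1 p hp
    · rcases Finset.mem_insert.mp hp with rfl | hp' <;>
        rcases Finset.mem_insert.mp hq with rfl | hq'
      · exact absurd rfl hpq
      · have := hfar q hq' g⁻¹
        rw [← isometry_transformation_smul g, smul_inv_smul, dist_comm] at this
        exact this.le
      · exact (hfar p hp' g).le
      · exact hP.2 p hp' q hq' hpq g
  have := hPmax _ hSep
  rw [Finset.card_insert_of_notMem hzP] at this
  omega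

end

/-! ### Boundedness of cusp forms for finite covolume -/

section

variable {Γ : Subgroup (GL (Fin 2) ℝ)}

theorem slash_apply_of_det_eq_one (φ : ℍ → ℂ) (k : ℤ) {g : GL (Fin 2) ℝ} (hg : g.det = 1) (z : ℍ) :
    (φ ∣[k] g) z = φ (g • z) * denom g z ^ (-k) := by
  have hd : g.det.val = 1 := by rw [hg]; rfl
  rw [ModularForm.slash_apply]
  simp only [UpperHalfPlane.σ, hd, zero_lt_one, if_true]
  simp

theorem im_smul_of_det_eq_one {g : GL (Fin 2) ℝ} (hg : g.det = 1) (z : ℍ) :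
    (g • z).im = z.im / ‖denom g z‖ ^ 2 := by
  have hd : g.det.val = 1 := by rw [hg]; rfl
  rw [im_smul_eq_div_normSq, hd, abs_one, one_mul, Complex.normSq_eq_norm_sq]

theorem norm_slash_mul_im_pow {k : ℕ} (hk : Even k) (φ : ℍ → ℂ) {g : GL (Fin 2) ℝ}
    (hg : g.det = 1) (z : ℍ) :
    ‖(φ ∣[(k : ℤ)] g) z‖ * z.im ^ (k / 2) = ‖φ (g • z)‖ * (g • z).im ^ (k / 2) := by
  obtain ⟨j, rfl⟩ := hk
  rw [slash_apply_of_det_eq_one φ _ hg, im_smul_of_det_eq_one hg, norm_mul, norm_zpow, zpow_neg,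
    zpow_natCast, div_pow, ← pow_mul]
  have : 2 * ((j + j) / 2) = j + j := by omega
  rw [this]
  ring

/-- As a function of `q`, `F` vanishes at 0, so `F / q` is holomorphic on the disc and the maximum
principle on `|q| ≤ exp (-2 π Y / h)` applies. -/
theorem norm_le_exp_of_isZeroAtImInfty {F : ℍ → ℂ} {h : ℝ} (hh : 0 < h)
    (hper : Function.Periodic (F ∘ ofComplex) h) (hhol : MDiff F) (hzero : IsZeroAtImInfty F)
    {Y M : ℝ} (hY : 0 < Y) (hM : ∀ w : ℍ, w.im = Y → ‖F w‖ ≤ M) {w : ℍ} (hw : Y ≤ w.im) :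
    ‖F w‖ ≤ M * Real.exp (-2 * Real.pi * (w.im - Y) / h) := by
  set G := cuspFunction h F with hG
  have hdiff : DifferentiableOn ℂ G (Metric.ball 0 1) :=
    differentiableOn_cuspFunction_ball hh hper hhol hzero.isBoundedAtImInfty
  have hG0 : G 0 = 0 := by
    rw [hG, cuspFunction_apply_zero hh
      (analyticAt_cuspFunction_zero hh hper hhol hzero.isBoundedAtImInfty) hper]
    exact hzero.valueAtInfty_eq_zero
  set r := Real.exp (-2 * Real.pi * Y / h) with hr
  have hr0 : 0 < r := Real.exp_pos _
  have hr1 : r < 1 := by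
    rw [hr, Real.exp_lt_one_iff]
    apply div_neg_of_neg_of_pos _ hh
    have := mul_pos Real.pi_pos hY
    linarith
  have hd : DifferentiableOn ℂ (dslope G 0) (Metric.ball 0 1) :=
    (Complex.differentiableOn_dslope (Metric.ball_mem_nhds _ one_pos)).mpr hdiff
  have hdc : DiffContOnCl ℂ (dslope G 0) (Metric.ball 0 r) := by
    refine hd.diffContOnCl_ball ?_
    exact Metric.closedBall_subset_ball hr1
  have hds : ∀ q ≠ 0, dslope G 0 q = G q / q := by
    intro q hq
    rw [dslope_of_ne _ hq, slope_def_field, hG0, sub_zero, sub_zero]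
  have hfr : ∀ q ∈ frontier (Metric.ball (0 : ℂ) r), ‖dslope G 0 q‖ ≤ M / r := by
    intro q hq
    rw [frontier_ball _ hr0.ne', mem_sphere_zero_iff_norm] at hq
    have hq0 : q ≠ 0 := by rw [← norm_pos_iff, hq]; exact hr0
    have him : (Function.Periodic.invQParam h q).im = Y := by
      rw [Function.Periodic.im_invQParam, hq, hr, Real.log_exp]
      have := Real.pi_pos
      field_simp
    let w' : ℍ := ⟨Function.Periodic.invQParam h q, by rw [him]; exact hY⟩
    have e : G q = F w' := by
      have := eq_cuspFunction w' hh.ne' hper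
      rw [← this, hG]
      congr 1
      exact (Function.Periodic.qParam_right_inv hh.ne' hq0).symm
    rw [hds q hq0, norm_div, hq, e]
    gcongr
    exact hM w' him
  have hq := Function.Periodic.norm_qParam h w
  have hqr : ‖Function.Periodic.qParam h w‖ ≤ r := by
    rw [hq, hr, Real.exp_le_exp]
    apply div_le_div_of_nonneg_right _ hh.le
    rw [coe_im]
    have := mul_le_mul_of_nonneg_left hw Real.pi_pos.le
    linarith
  have hq0 : Function.Periodic.qParam h w ≠ 0 := Function.Periodic.qParam_ne_zero _
  have hmax := Complex.norm_le_of_forall_mem_frontier_norm_le Metric.isBounded_ball hdc hfr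
    (z := Function.Periodic.qParam h w) (by
      rw [closure_ball _ hr0.ne']; simpa using hqr)
  rw [hds _ hq0, norm_div, div_le_iff₀ (norm_pos_iff.mpr hq0), hG,
    eq_cuspFunction w hh.ne' hper] at hmax
  refine hmax.trans (le_of_eq ?_)
  rw [hq, hr, coe_im, div_mul_eq_mul_div, mul_div_assoc, ← Real.exp_sub]
  congr 2
  ring

theorem deviation_upperRightHom (x : ℝ) (w : ℍ) :
    deviation (Matrix.GeneralLinearGroup.upperRightHom x).val w = (x / w.im) ^ 2 := by
  simp [deviation]

theorem deviation_neg (M : Matrix (Fin 2) (Fin 2) ℝ) (z : ℍ) :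
    deviation (-M) z = deviation M z := by
  simp only [deviation, Matrix.neg_apply]
  ring

theorem not_isScalarMatrix_iff {M : Matrix (Fin 2) (Fin 2) ℝ} :
    ¬ IsScalarMatrix M ↔ M ∉ Set.range (Matrix.scalar (Fin 2)) := by
  rw [not_iff_not]
  constructor
  · rintro ⟨h1, h2, h3⟩
    exact ⟨M 0 0, by ext i j; fin_cases i <;> fin_cases j <;> simp [h1, h2, h3]⟩
  · rintro ⟨a, rfl⟩
    simp [IsScalarMatrix]

theorem isParabolic_of_trace_sq {g : GL (Fin 2) ℝ} (hg : g.det = 1) (h : g.val.trace ^ 2 = 4)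
    (hns : ¬ IsScalarMatrix g.val) : g.IsParabolic := by
  refine ⟨not_isScalarMatrix_iff.mp hns, ?_⟩
  have : g.val.det = 1 := by
    rw [← Matrix.GeneralLinearGroup.val_det_apply, hg]; rfl
  rw [Matrix.discr_fin_two, this, h]
  norm_num

/-- The traces of the non-parabolic minimal elements with small deviation come, up to conjugation,
from a finite set, so `tr²` keeps a distance from 4; this distance bounds the deviation from below.
-/
theorem exists_trace_sq_eq_of_deviation_lt [Γ.HasDetOne] [DiscreteTopology Γ] {D : Set ℍ}
    (hD : IsFundamentalDomain (transformationGroup Γ) D) (hV : volume D < ⊤) :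
    ∃ ε : ℝ, 0 < ε ∧ ε ≤ 1 / 256 ∧ ∀ A z, IsMinimalAt Γ A z → deviation A.val z < ε →
      A.val.trace ^ 2 = 4 := by
  obtain ⟨K, hK, hKΓ⟩ := exists_isCompact_of_thickPart hD hV (ε := 1 / 256) (by norm_num)
  have hfin : {γ | γ ∈ Γ ∧ ∃ z ∈ K, deviation γ.val z ≤ 1 / 256}.Finite := by
    refine (finite_setOf_mem_smul_inter (Γ := Γ) hK (hK.cthickening (r := 2 + 2 * (1 / 256)))).subset ?_
    rintro γ ⟨hγ, z, hz, hd⟩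
    refine ⟨hγ, γ • z, ⟨z, hz, rfl⟩, ?_⟩
    refine Metric.mem_cthickening_of_dist_le _ z _ _ hz ?_
    rw [dist_comm]
    exact dist_smul_le_of_deviation_le (Subgroup.HasDetOne.det_eq hγ) hd
  obtain ⟨ε, hε0, hε⟩ : ∃ ε : ℝ, 0 < ε ∧ ∀ γ ∈ {γ | γ ∈ Γ ∧ ∃ z ∈ K, deviation γ.val z ≤ 1 / 256},
      γ.val.trace ^ 2 ≠ 4 → ε ≤ |γ.val.trace ^ 2 - 4| / 2 := by
    have := hfin.inter_of_left {γ : GL (Fin 2) ℝ | γ.val.trace ^ 2 ≠ 4}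
    rcases Set.eq_empty_or_nonempty ({γ | γ ∈ Γ ∧ ∃ z ∈ K, deviation γ.val z ≤ 1 / 256} ∩
      {γ : GL (Fin 2) ℝ | γ.val.trace ^ 2 ≠ 4}) with he | hne
    · refine ⟨1, one_pos, fun γ hγ hγ' ↦ ?_⟩
      have : γ ∈ (∅ : Set (GL (Fin 2) ℝ)) := he ▸ ⟨hγ, hγ'⟩
      exact this.elim
    · obtain ⟨γ₀, h₀, hmin⟩ := Set.exists_min_image _ (fun γ : GL (Fin 2) ℝ ↦
        |γ.val.trace ^ 2 - 4| / 2) this hne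
      refine ⟨|γ₀.val.trace ^ 2 - 4| / 2, ?_, fun γ hγ hγ' ↦ hmin γ ⟨hγ, hγ'⟩⟩
      have := abs_pos.mpr (sub_ne_zero.mpr h₀.2)
      linarith
  refine ⟨min ε (1 / 256), by positivity, min_le_right _ _, fun A z hA hlt ↦ ?_⟩
  by_contra hne
  have dA := Subgroup.HasDetOne.det_eq hA.mem
  -- Moving to a point where the deviation of `A` is exactly `1 / 256` keeps `A` minimal, so this
  -- point is thick and can be brought into the compact set `K`.
  obtain ⟨z', hz'⟩ := exists_deviation_eq hA.nonscalar (hlt.le.trans (min_le_right ε (1 / 256)))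
  have hA' := hA.of_deviation_lt (z' := z') (by rw [hz']; norm_num)
  obtain ⟨γ, hγ, hγK⟩ := hKΓ z' (hA'.mem_thickPart hz'.ge)
  have dγ := Subgroup.HasDetOne.det_eq hγ
  have htr : (γ * A * γ⁻¹).val.trace = A.val.trace := by
    rw [Units.val_mul, Units.val_mul, Matrix.trace_units_conj]
  have := hε (γ * A * γ⁻¹) ⟨Γ.mul_mem (Γ.mul_mem hγ hA.mem) (Γ.inv_mem hγ), γ • z', hγK, by
    rw [deviation_conj dA dγ, hz']⟩ (by rwa [htr])
  rw [htr] at this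
  have h2 := abs_trace_sq_sub_four_le dA z
  have h3 := hlt.trans_le (min_le_left ε (1 / 256))
  linarith

theorem pow_mul_exp_le {t : ℝ} (ht : 1 ≤ t) (j : ℕ) {c : ℝ} (hc : 1 ≤ c) :
    t ^ j * Real.exp (-c * (t - 1)) ≤ j.factorial * Real.exp 1 := by
  have h1 : t ^ j / j.factorial ≤ Real.exp t := Real.pow_div_factorial_le_exp t (by linarith) j
  have h2 : Real.exp (-c * (t - 1)) ≤ Real.exp (1 - t) := by
    rw [Real.exp_le_exp]; nlinarith
  rw [div_le_iff₀ (by positivity)] at h1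
  calc t ^ j * Real.exp (-c * (t - 1)) ≤ (Real.exp t * j.factorial) * Real.exp (1 - t) := by
        gcongr
    _ = j.factorial * (Real.exp t * Real.exp (1 - t)) := by ring
    _ = j.factorial * Real.exp 1 := by rw [← Real.exp_add]; congr 2; ring

/-- With the fixed point of `A` moved to `∞`, `A` is `±` a translation by `x`, with deviation `(x /
Im w) ^ 2`. The horocycle of deviation `1 / 256` lies in the thick part, where `M` bounds `f`. Above
it, exponential decay beats the growth of `y ^ (k / 2)`. -/
theorem IsMinimalAt.norm_mul_im_pow_le_of_isParabolic [Γ.HasDetOne] [DiscreteTopology Γ]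
    {k : ℕ} (hk : Even k) (f : CuspForm Γ k) {A : GL (Fin 2) ℝ} {z : ℍ} (hA : IsMinimalAt Γ A z)
    (hpar : A.IsParabolic) (hAz : deviation A.val z ≤ 1 / 256) {M : ℝ}
    (hM : ∀ z ∈ thickPart Γ (1 / 256), ‖f z‖ * z.im ^ (k / 2) ≤ M) :
    ‖f z‖ * z.im ^ (k / 2) ≤ M * ((k / 2).factorial * Real.exp 1) := by
  have dA := Subgroup.HasDetOne.det_eq hA.mem
  have hfix : A • A.parabolicFixedPoint = A.parabolicFixedPoint := hpar.smul_eq_self_iff.mpr rfl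
  obtain ⟨τ', hτ'⟩ := OnePoint.exists_mem_SL2 ℝ A.parabolicFixedPoint
  set τ := Matrix.SpecialLinearGroup.mapGL ℝ τ' with hτ
  have dτ : τ.det = 1 := by ext; simp [hτ]
  have hcusp : A.parabolicFixedPoint.IsZeroAt f k :=
    CuspFormClass.zero_at_cusps f ⟨A, hA.mem, hpar, hfix⟩
  set F : ℍ → ℂ := (f : ℍ → ℂ) ∣[(k : ℤ)] τ with hF
  have hFzero : IsZeroAtImInfty F := hcusp τ hτ'
  have hFhol : MDiff F := (CuspFormClass.holo f).slash k τ
  set B := τ⁻¹ * A * τ with hB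
  have dB : B.det = 1 := by simp [hB, dA]
  have hBpar : B.IsParabolic := by simpa [hB] using hpar
  have hB10 : B 1 0 = 0 := by
    rw [← OnePoint.smul_infty_eq_self_iff, hB, mul_smul, mul_smul, hτ', hfix, ← hτ',
      inv_smul_smul]
  have hFB : F ∣[(k : ℤ)] B = F := by
    have : (f : ℍ → ℂ) ∣[(k : ℤ)] A = f := SlashInvariantFormClass.slash_action_eq f A hA.mem
    rw [hF, hB, ← SlashAction.slash_mul]
    conv_rhs => rw [← this]
    rw [← SlashAction.slash_mul]
    congr 1
    group
  obtain ⟨x, hx, hFx, hdev⟩ : ∃ x : ℝ, x ≠ 0 ∧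
      F ∣[(k : ℤ)] (Matrix.GeneralLinearGroup.upperRightHom x) = F ∧
      ∀ w, deviation B.val w = (x / w.im) ^ 2 := by
    rcases (Matrix.GeneralLinearGroup.isParabolic_iff_of_upperTriangular_of_det
      (by left; exact dB) hB10).mp hBpar with ⟨x, hx, h⟩ | ⟨x, hx, h⟩
    · exact ⟨x, hx, h ▸ hFB, fun w ↦ by rw [h, deviation_upperRightHom]⟩
    · refine ⟨x, hx, ?_, fun w ↦ by rw [h, Units.val_neg, deviation_neg, deviation_upperRightHom]⟩
      rw [← slash_neg_of_even hk, ← h, hFB]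
  have hdevA : ∀ w, deviation A.val (τ • w) = (x / w.im) ^ 2 := by
    intro w
    rw [← hdev, hB]
    have := deviation_conj dA (t := τ⁻¹) (by simp [dτ]) (τ • w)
    rw [inv_smul_smul, inv_inv] at this
    exact this.symm
  have hFx' : ∀ w : ℍ, F (x +ᵥ w) = F w := by
    intro w
    conv_rhs => rw [← hFx]
    have : Matrix.GeneralLinearGroup.upperRightHom x • w = x +ᵥ w := by
      ext
      simp [UpperHalfPlane.σ, num, denom, coe_vadd, UpperHalfPlane.coe_smul, add_comm]
    rw [slash_apply_of_det_eq_one _ _ (by ext; simp), this]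
    simp [denom]
  have hper0 : Function.Periodic (F ∘ ofComplex) (x : ℂ) := by
    intro w
    by_cases! hw : 0 < w.im
    · have : 0 < (w + x).im := by simp [hw]
      simp only [Function.comp_apply, ofComplex_apply_of_im_pos this, ofComplex_apply_of_im_pos hw]
      rw [← hFx' ⟨w, hw⟩]
      congr 1
      ext
      simp [add_comm]
    · have : (w + x).im ≤ 0 := by simpa using hw
      simp [ofComplex_apply_of_im_nonpos this, ofComplex_apply_of_im_nonpos hw]
  have hper : Function.Periodic (F ∘ ofComplex) ((|x| : ℝ) : ℂ) := by
    rcases abs_choice x with h | h <;> rw [h]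
    · exact hper0
    · push_cast
      exact hper0.neg
  have hx0 : 0 < |x| := abs_pos.mpr hx
  have hweight : ∀ w : ℍ, ‖F w‖ * w.im ^ (k / 2) = ‖f (τ • w)‖ * (τ • w).im ^ (k / 2) :=
    fun w ↦ norm_slash_mul_im_pow hk f dτ w
  -- The height at which the deviation `(x / Y) ^ 2` equals `1 / 256`.
  set Y := 16 * |x| with hY
  have hY0 : 0 < Y := by positivity
  have hcircle : ∀ w : ℍ, w.im = Y → ‖F w‖ ≤ M / Y ^ (k / 2) := by
    intro w hw
    rw [le_div_iff₀ (by positivity), ← hw, hweight]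
    apply hM
    have hd : deviation A.val (τ • w) = 1 / 256 := by
      rw [hdevA, hw, hY, div_pow, mul_pow, sq_abs]
      field_simp
      norm_num
    exact (hA.of_deviation_lt (by rw [hd]; norm_num)).mem_thickPart hd.ge
  set w := τ⁻¹ • z with hw
  have hzw : z = τ • w := by rw [hw, smul_inv_smul]
  have hYw : Y ≤ w.im := by
    rw [hzw, hdevA, ← sq_abs, abs_div, abs_of_pos w.im_pos] at hAz
    have h1 : |x| / w.im ≤ 1 / 16 := by
      apply le_of_sq_le_sq _ (by norm_num)
      linarith
    rw [div_le_iff₀ w.im_pos] at h1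
    linarith
  have hbound := norm_le_exp_of_isZeroAtImInfty hx0 hper hFhol hFzero hY0 hcircle hYw
  have hM0 : 0 ≤ M := by
    have h : 0 ≤ M / Y ^ (k / 2) := (norm_nonneg _).trans (hcircle ⟨⟨0, Y⟩, hY0⟩ rfl)
    have h2 : 0 < Y ^ (k / 2) := by positivity
    by_contra! hneg
    exact (div_neg_of_neg_of_pos hneg h2).not_ge h
  rw [hzw, ← hweight]
  have ht : 1 ≤ w.im / Y := (one_le_div hY0).mpr hYw
  calc ‖F w‖ * w.im ^ (k / 2)
      ≤ M / Y ^ (k / 2) * Real.exp (-2 * Real.pi * (w.im - Y) / |x|) * w.im ^ (k / 2) := by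
        have := w.im_pos
        gcongr
    _ = M * ((w.im / Y) ^ (k / 2) * Real.exp (-(32 * Real.pi) * (w.im / Y - 1))) := by
        have e : -2 * Real.pi * (w.im - Y) / |x| = -(32 * Real.pi) * (w.im / Y - 1) := by
          rw [hY]; field_simp; ring
        rw [e, div_pow]
        ring
    _ ≤ M * ((k / 2).factorial * Real.exp 1) := by
        refine mul_le_mul_of_nonneg_left (pow_mul_exp_le ht _ ?_) hM0
        have := Real.pi_gt_three
        linarith

theorem exists_bound_of_finite_covolume [Γ.HasDetOne] [DiscreteTopology Γ] {D : Set ℍ}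
    (hD : IsFundamentalDomain (transformationGroup Γ) D) (hV : volume D < ⊤)
    (hΓ : ∃ B ∈ Γ, ¬ IsScalarMatrix B.val) {k : ℕ} (hk : Even k) (f : CuspForm Γ k) :
    ∃ C, ∀ z, ‖f z‖ * z.im ^ (k / 2) ≤ C := by
  have hcont : Continuous fun z ↦ ‖f z‖ * z.im ^ (k / 2) :=
    (CuspFormClass.holo f).continuous.norm.mul (continuous_im.pow _)
  have hinv : ∀ γ ∈ Γ, ∀ z, ‖f (γ • z)‖ * (γ • z).im ^ (k / 2) = ‖f z‖ * z.im ^ (k / 2) := by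
    intro γ hγ z
    rw [← norm_slash_mul_im_pow hk f (Subgroup.HasDetOne.det_eq hγ),
      SlashInvariantFormClass.slash_action_eq f γ hγ]
  have hthick : ∀ ε : ℝ, 0 < ε → ∃ M, ∀ z ∈ thickPart Γ ε, ‖f z‖ * z.im ^ (k / 2) ≤ M := by
    intro ε hε
    obtain ⟨K, hK, hKΓ⟩ := exists_isCompact_of_thickPart hD hV hε
    obtain ⟨M, hM⟩ := (hK.image hcont).bddAbove
    refine ⟨M, fun z hz ↦ ?_⟩
    obtain ⟨γ, hγ, hγK⟩ := hKΓ z hz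
    rw [← hinv γ hγ]
    exact hM ⟨_, hγK, rfl⟩
  obtain ⟨ε, hε0, hε1, hε⟩ := exists_trace_sq_eq_of_deviation_lt hD hV
  obtain ⟨M₁, hM₁⟩ := hthick ε hε0
  obtain ⟨M₂, hM₂⟩ := hthick (1 / 256) (by norm_num)
  refine ⟨max M₁ (M₂ * ((k / 2).factorial * Real.exp 1)), fun z ↦ ?_⟩
  obtain ⟨A, hA⟩ := exists_isMinimalAt hΓ z
  by_cases h : ε ≤ deviation A.val z
  · exact (hM₁ z (hA.mem_thickPart h)).trans (le_max_left _ _)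
  · push Not at h
    have hpar := isParabolic_of_trace_sq (Subgroup.HasDetOne.det_eq hA.mem) (hε A z hA h)
      hA.nonscalar
    exact (hA.norm_mul_im_pow_le_of_isParabolic hk f hpar (h.le.trans hε1) hM₂).trans
      (le_max_right _ _)

end

/-! ### Unfolding over cosets -/

section

variable {Γ Γ₀ : Subgroup (GL (Fin 2) ℝ)}

/-- The transformation given by the representative of a coset `Γ₀ γ`. -/
def cosetTransformation (q : RightCosets Γ Γ₀) : transformationGroup Γ :=
  toTransformation Γ q.out

@[simp]
theorem cosetTransformation_smul (q : RightCosets Γ Γ₀) (z : ℍ) :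
    cosetTransformation q • z = (q.out : GL (Fin 2) ℝ) • z := rfl

theorem mk_out_mul_inv_mem (γ : Γ) :
    ((Quotient.mk (QuotientGroup.rightRel (Γ₀.subgroupOf Γ)) γ).out : GL (Fin 2) ℝ) * γ⁻¹ ∈ Γ₀ := by
  have h : QuotientGroup.rightRel (Γ₀.subgroupOf Γ)
      (Quotient.mk (QuotientGroup.rightRel (Γ₀.subgroupOf Γ)) γ).out γ := Quotient.mk_out γ
  rw [QuotientGroup.rightRel_apply, Subgroup.mem_subgroupOf] at h
  have := Γ₀.inv_mem h
  simpa using this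

theorem rightCosets_ext {q q' : RightCosets Γ Γ₀}
    (h : (q.out : GL (Fin 2) ℝ) * (q'.out : GL (Fin 2) ℝ)⁻¹ ∈ Γ₀) : q = q' := by
  rw [← Quotient.out_eq q, ← Quotient.out_eq q']
  refine (Quotient.sound ?_).symm
  change QuotientGroup.rightRel _ _ _
  rw [QuotientGroup.rightRel_apply, Subgroup.mem_subgroupOf]
  exact h

instance [Γ.HasDetOne] [DiscreteTopology Γ] : Countable (RightCosets Γ Γ₀) :=
  inferInstanceAs (Countable (Quotient _))

/-- The union of the translates of `D` by representatives of the cosets in `Γ₀ \ Γ`. -/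
def cosetUnion (Γ Γ₀ : Subgroup (GL (Fin 2) ℝ)) (D : Set ℍ) : Set ℍ :=
  ⋃ q : RightCosets Γ Γ₀, cosetTransformation q • D

theorem integrableOn_comp_out {E : Type*} [NormedAddCommGroup E] {ψ : ℍ → E} {D : Set ℍ}
    (hint : IntegrableOn ψ (cosetUnion Γ Γ₀ D)) (q : RightCosets Γ Γ₀) :
    IntegrableOn (fun z ↦ ψ ((q.out : GL (Fin 2) ℝ) • z)) D := by
  have h1 : IntegrableOn ψ (cosetTransformation q • D) :=
    hint.mono_set (Set.subset_iUnion (fun q : RightCosets Γ Γ₀ ↦ cosetTransformation q • D) q)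
  have := (measurePreserving_smul (cosetTransformation q) (volume : Measure ℍ)).integrableOn_image
    (measurableEmbedding_const_smul _) (f := ψ) (s := D)
  exact this.mp h1

section

variable (hle : Γ₀ ≤ Γ) (hker : ∀ γ ∈ Γ, (∀ z : ℍ, γ • z = z) → γ ∈ Γ₀)
include hle hker

/-- Matrices and transformations differ by the kernel of the action. Since `Γ₀` contains the part of
this kernel in `Γ`, equality of transformations up to `Γ₀` determines the coset. -/
theorem eq_of_smul_out_eq {q q' : RightCosets Γ Γ₀} {δ δ' : GL (Fin 2) ℝ} (hδ : δ ∈ Γ₀)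
    (hδ' : δ' ∈ Γ₀) (h : ∀ z : ℍ, δ • (q.out : GL (Fin 2) ℝ) • z =
      δ' • (q'.out : GL (Fin 2) ℝ) • z) : q = q' := by
  apply rightCosets_ext
  set a := (q.out : GL (Fin 2) ℝ)
  set b := (q'.out : GL (Fin 2) ℝ)
  have ha : a ∈ Γ := q.out.2
  have hb : b ∈ Γ := q'.out.2
  have hκ : δ * a * (δ' * b)⁻¹ ∈ Γ₀ := by
    refine hker _ (Γ.mul_mem (Γ.mul_mem (hle hδ) ha) (Γ.inv_mem (Γ.mul_mem (hle hδ') hb))) fun z ↦ ?_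
    have := h ((δ' * b)⁻¹ • z)
    simpa [mul_smul] using this
  have : a * b⁻¹ = δ⁻¹ * (δ * a * (δ' * b)⁻¹) * δ' := by group
  rw [this]
  exact Γ₀.mul_mem (Γ₀.mul_mem (Γ₀.inv_mem hδ) hκ) hδ'

variable {D : Set ℍ} (hD : IsFundamentalDomain (transformationGroup Γ) D)
include hD

theorem aedisjoint_coset_smul {q q' : RightCosets Γ Γ₀} (hne : q ≠ q') :
    AEDisjoint volume (cosetTransformation q • D) (cosetTransformation q' • D) := by
  refine hD.aedisjoint fun h ↦ hne ?_
  refine eq_of_smul_out_eq hle hker Γ₀.one_mem Γ₀.one_mem fun z ↦ ?_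
  rw [one_smul, one_smul, ← cosetTransformation_smul, ← cosetTransformation_smul, h]

variable [Γ.HasDetOne] [DiscreteTopology Γ]

theorem isFundamentalDomain_cosetUnion :
    IsFundamentalDomain (transformationGroup Γ₀) (cosetUnion Γ Γ₀ D) where
  nullMeasurableSet := NullMeasurableSet.iUnion fun q ↦ hD.nullMeasurableSet_smul _
  ae_covers := by
    filter_upwards [hD.ae_covers] with z ⟨g, hg⟩
    obtain ⟨γ, rfl⟩ := toTransformation_surjective g
    refine ⟨toTransformation Γ₀ ⟨_, mk_out_mul_inv_mem γ⁻¹⟩, ?_⟩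
    refine Set.mem_iUnion.mpr ⟨Quotient.mk _ γ⁻¹, ?_⟩
    rw [toTransformation_smul] at hg
    refine ⟨_, hg, ?_⟩
    simp [mul_smul]
  aedisjoint := by
    intro h₁ h₂ hne
    change AEDisjoint volume (h₁ • cosetUnion Γ Γ₀ D) (h₂ • cosetUnion Γ Γ₀ D)
    obtain ⟨⟨δ₁, hδ₁⟩, rfl⟩ := toTransformation_surjective h₁
    obtain ⟨⟨δ₂, hδ₂⟩, rfl⟩ := toTransformation_surjective h₂
    have key : ∀ δ, ∀ hδ : δ ∈ Γ₀, toTransformation Γ₀ ⟨δ, hδ⟩ • cosetUnion Γ Γ₀ D =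
        ⋃ q : RightCosets Γ Γ₀, (toTransformation Γ ⟨δ, hle hδ⟩ * cosetTransformation q) • D := by
      intro δ hδ
      rw [cosetUnion, Set.smul_set_iUnion]
      refine Set.iUnion_congr fun q ↦ ?_
      rw [mul_smul]
      rfl
    rw [key, key, AEDisjoint.iUnion_left_iff]
    intro q
    rw [AEDisjoint.iUnion_right_iff]
    intro q'
    refine hD.aedisjoint fun heq ↦ hne ?_
    have hz : ∀ z : ℍ, δ₁ • (q.out : GL (Fin 2) ℝ) • z = δ₂ • (q'.out : GL (Fin 2) ℝ) • z :=
      fun z ↦ congrArg (fun g : transformationGroup Γ ↦ g • z) heq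
    obtain rfl := eq_of_smul_out_eq hle hker hδ₁ hδ₂ hz
    refine transformation_ext fun z ↦ ?_
    have := hz ((q.out : GL (Fin 2) ℝ)⁻¹ • z)
    simpa using this

/-- The translates of `D` are almost disjoint and the action preserves the measure. -/
theorem hasSum_integral_cosetUnion {E : Type*} [NormedAddCommGroup E] [NormedSpace ℝ E]
    {ψ : ℍ → E} (hint : IntegrableOn ψ (cosetUnion Γ Γ₀ D)) :
    HasSum (fun q : RightCosets Γ Γ₀ ↦ ∫ z in D, ψ ((q.out : GL (Fin 2) ℝ) • z))
      (∫ z in cosetUnion Γ Γ₀ D, ψ z) := by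
  have h := hasSum_integral_iUnion_ae (μ := volume) (f := ψ)
    (s := fun q : RightCosets Γ Γ₀ ↦ cosetTransformation q • D)
    (fun q ↦ hD.nullMeasurableSet_smul _) (fun q q' hne ↦ aedisjoint_coset_smul hle hker hD hne) hint
  convert! h using 1
  funext q
  exact ((measurePreserving_smul (cosetTransformation q) (volume : Measure ℍ)).setIntegral_image_emb
    (measurableEmbedding_const_smul _) ψ D).symm

variable {S : Set ℍ} (hS : IsFundamentalDomain (transformationGroup Γ₀) S) {ψ : ℍ → ℂ}
  (hψ : ∀ γ ∈ Γ₀, ∀ z, ψ (γ • z) = ψ z)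
include hS hψ

theorem integrableOn_cosetUnion [Countable (transformationGroup Γ₀)] (hint : IntegrableOn ψ S) :
    IntegrableOn ψ (cosetUnion Γ Γ₀ D) := by
  refine (hS.integrableOn_iff (isFundamentalDomain_cosetUnion hle hker hD) fun g z ↦ ?_).mp hint
  obtain ⟨γ, hγ, h⟩ := exists_smul_eq g
  rw [h, hψ γ hγ]

/-- Both `S` and the union of coset translates of `D` are fundamental domains for `Γ₀`, so an
invariant function has the same integral over them. Fubini for the sum over cosets gives the rest,
with integrability of the norm as its justification. -/
theorem unfolding [Countable (transformationGroup Γ₀)] (hint : IntegrableOn ψ S) :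
    (∀ᵐ z ∂volume.restrict D, Summable fun q : RightCosets Γ Γ₀ ↦
      ‖ψ ((q.out : GL (Fin 2) ℝ) • z)‖) ∧
    IntegrableOn (fun z ↦ ∑' q : RightCosets Γ Γ₀, ψ ((q.out : GL (Fin 2) ℝ) • z)) D ∧
    ∫ z in D, ∑' q : RightCosets Γ Γ₀, ψ ((q.out : GL (Fin 2) ℝ) • z) = ∫ z in S, ψ z := by
  have hint' := integrableOn_cosetUnion hle hker hD hS hψ hint
  have hq := integrableOn_comp_out (D := D) hint'
  have hsum := (hasSum_integral_cosetUnion hle hker hD hint'.norm).summable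
  have hlin : ∑' q : RightCosets Γ Γ₀, ∫⁻ z in D, ‖ψ ((q.out : GL (Fin 2) ℝ) • z)‖ₑ ≠ ⊤ := by
    have e : ∀ q : RightCosets Γ Γ₀, ∫⁻ z in D, ‖ψ ((q.out : GL (Fin 2) ℝ) • z)‖ₑ =
        ENNReal.ofReal (∫ z in D, ‖ψ ((q.out : GL (Fin 2) ℝ) • z)‖) := fun q ↦
      (ofReal_integral_norm_eq_lintegral_enorm (hq q)).symm
    rw [funext e]
    exact hsum.tsum_ofReal_ne_top
  have hmeas : ∀ q : RightCosets Γ Γ₀, AEStronglyMeasurable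
      (fun z ↦ ψ ((q.out : GL (Fin 2) ℝ) • z)) (volume.restrict D) := fun q ↦ (hq q).1
  have hlin2 : ∫⁻ z in D, ∑' q : RightCosets Γ Γ₀, ‖ψ ((q.out : GL (Fin 2) ℝ) • z)‖ₑ ≠ ⊤ := by
    rwa [lintegral_tsum fun q ↦ (hmeas q).enorm]
  have hae : ∀ᵐ z ∂volume.restrict D, Summable fun q : RightCosets Γ Γ₀ ↦
      ‖ψ ((q.out : GL (Fin 2) ℝ) • z)‖ := by
    filter_upwards [ae_lt_top' (AEMeasurable.tsum fun q ↦ (hmeas q).enorm) hlin2] with z hz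
    have := tsum_enorm_ne_top_iff_summable_nnnorm.mp hz.ne
    exact NNReal.summable_coe.mpr this
  refine ⟨hae, ⟨?_, ?_⟩, ?_⟩
  · refine aestronglyMeasurable_of_tendsto_ae (u := Filter.atTop)
      (f := fun (s : Finset (RightCosets Γ Γ₀)) z ↦ ∑ q ∈ s, ψ ((q.out : GL (Fin 2) ℝ) • z))
      (fun s ↦ ?_) ?_
    · exact Finset.aestronglyMeasurable_fun_sum s fun q _ ↦ hmeas q
    · filter_upwards [hae] with z hz
      exact hz.of_norm.hasSum
  · exact (lintegral_mono fun z ↦ enorm_tsum_le_tsum_enorm).trans_lt hlin2.lt_top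
  · rw [← integral_tsum_of_summable_integral_norm hq hsum,
      (hasSum_integral_cosetUnion hle hker hD hint').tsum_eq]
    refine (isFundamentalDomain_cosetUnion hle hker hD).setIntegral_eq hS fun g z ↦ ?_
    obtain ⟨γ, hγ, h⟩ := exists_smul_eq g
    rw [h, hψ γ hγ]

end

end

/-! ### The half annulus and size estimates for the hyperbolic power -/

section

theorem peterssonIntegrand_slash {k : ℕ} (f h : ℍ → ℂ) {g : GL (Fin 2) ℝ} (hg : g.det = 1) (z : ℍ) :
    peterssonIntegrand k (f ∣[(k : ℤ)] g) (h ∣[(k : ℤ)] g) z = peterssonIntegrand k f h (g • z) := by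
  have hj : denom g z ≠ 0 := denom_ne_zero g z
  have hj' : (starRingEnd ℂ) (denom g z) ≠ 0 := (map_ne_zero _).mpr hj
  have him : ((g • z).im : ℂ) = z.im / (denom g z * (starRingEnd ℂ) (denom g z)) := by
    rw [im_smul_of_det_eq_one hg, Complex.mul_conj, Complex.normSq_eq_norm_sq]
    push_cast
    rfl
  simp only [peterssonIntegrand]
  rw [slash_apply_of_det_eq_one f _ hg, slash_apply_of_det_eq_one h _ hg, him, map_mul, map_zpow₀,
    zpow_neg, zpow_neg, zpow_natCast, zpow_natCast, div_pow, mul_pow]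
  field_simp

theorem norm_peterssonIntegrand {k : ℕ} (hk : Even k) (f h : ℍ → ℂ) (z : ℍ) :
    ‖peterssonIntegrand k f h z‖ = (‖f z‖ * z.im ^ (k / 2)) * (‖h z‖ * z.im ^ (k / 2)) := by
  obtain ⟨j, rfl⟩ := hk
  have : (j + j) / 2 = j := by omega
  rw [this, peterssonIntegrand, norm_mul, norm_mul, RCLike.norm_conj, norm_pow, Complex.norm_real,
    Real.norm_of_nonneg z.im_pos.le, pow_add]
  ring

/-- The points `w ∈ ℍ` with `1 ≤ |w| < ξ ^ 2`. -/
def halfAnnulus (ξ : ℝ) : Set ℍ := {w | 1 ≤ ‖(w : ℂ)‖ ∧ ‖(w : ℂ)‖ < ξ ^ 2}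

theorem measurableSet_halfAnnulus (ξ : ℝ) : MeasurableSet (halfAnnulus ξ) :=
  (measurableSet_le measurable_const (continuous_coe.norm.measurable)).inter
    (measurableSet_lt (continuous_coe.norm.measurable) measurable_const)

theorem norm_diag_smul {ξ : ℝ} (hξ : 0 < ξ) {δ : GL (Fin 2) ℝ}
    (hδ : δ.val = !![ξ, 0; 0, ξ⁻¹] ∨ δ.val = -!![ξ, 0; 0, ξ⁻¹]) (w : ℍ) :
    ‖((δ • w : ℍ) : ℂ)‖ = ξ ^ 2 * ‖(w : ℂ)‖ := by
  have hdet : δ.det.val = 1 := by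
    rw [Matrix.GeneralLinearGroup.val_det_apply]
    rcases hδ with h | h <;> rw [h] <;> simp [Matrix.det_fin_two, hξ.ne']
  rw [coe_smul_of_det_pos (by rw [hdet]; norm_num)]
  have hξ' : (ξ : ℂ) ≠ 0 := by exact_mod_cast hξ.ne'
  have : num δ w / denom δ w = ((ξ ^ 2 : ℝ) : ℂ) * w := by
    rcases hδ with h | h <;> simp only [num, denom, h] <;> simp <;> field_simp
  rw [this, norm_mul, Complex.norm_real, Real.norm_of_nonneg (by positivity)]

theorem norm_zpow_smul {c : ℝ} (hc : 0 < c) {δ : GL (Fin 2) ℝ}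
    (hδ : ∀ w : ℍ, ‖((δ • w : ℍ) : ℂ)‖ = c * ‖(w : ℂ)‖) (n : ℤ) (w : ℍ) :
    ‖((δ ^ n • w : ℍ) : ℂ)‖ = c ^ n * ‖(w : ℂ)‖ := by
  induction n using Int.induction_on generalizing w with
  | zero => simp
  | succ n ih => rw [zpow_add_one, mul_smul, ih, hδ, zpow_add_one₀ hc.ne', mul_assoc]
  | pred n ih =>
    have := hδ (δ⁻¹ • w)
    rw [smul_inv_smul] at this
    rw [zpow_sub_one, mul_smul, ih, zpow_sub_one₀ hc.ne', this, mul_assoc, inv_mul_cancel_left₀ hc.ne']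

variable {Γ : Subgroup (GL (Fin 2) ℝ)} {η₁ η₂ : OnePoint ℝ} {γη σ : GL (Fin 2) ℝ} {ξ : ℝ}

theorem IsHyperbolicScaling.norm_zpow_smul (h : IsHyperbolicScaling Γ η₁ η₂ γη σ ξ) (n : ℤ) (z : ℍ) :
    ‖((σ⁻¹ • γη ^ n • z : ℍ) : ℂ)‖ = (ξ ^ 2) ^ n * ‖((σ⁻¹ • z : ℍ) : ℂ)‖ := by
  have hξ : 0 < ξ := one_pos.trans h.one_lt
  rw [← _root_.norm_zpow_smul (by positivity) (norm_diag_smul hξ h.conj) n]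
  congr 2
  have : (σ⁻¹ * γη * σ) ^ n = σ⁻¹ * γη ^ n * σ := by
    have := (conj_zpow (i := n) (a := σ⁻¹) (b := γη))
    simpa using this
  rw [this]
  simp [mul_smul]

/-- After moving by `σ⁻¹`, the generator multiplies `|w|` by `ξ ^ 2`, so exactly one power of it
brings `|w|` into `[1, ξ ^ 2)`; the sign acts trivially. -/
theorem IsHyperbolicScaling.isFundamentalDomain (h : IsHyperbolicScaling Γ η₁ η₂ γη σ ξ) :
    IsFundamentalDomain (transformationGroup (pairStabilizer Γ η₁ η₂)) (σ • halfAnnulus ξ) := by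
  have hξ1 : 1 < ξ ^ 2 := one_lt_pow₀ h.one_lt two_ne_zero
  have hmem : ∀ z : ℍ, z ∈ σ • halfAnnulus ξ ↔ σ⁻¹ • z ∈ halfAnnulus ξ :=
    fun z ↦ Set.mem_smul_set_iff_inv_smul_mem
  refine IsFundamentalDomain.mk'
    ((measurableSet_halfAnnulus ξ).const_smul σ).nullMeasurableSet fun z ↦ ?_
  have hw : 0 < ‖((σ⁻¹ • z : ℍ) : ℂ)‖ := norm_pos_iff.mpr (σ⁻¹ • z).ne_zero
  obtain ⟨n, hn1, hn2⟩ := exists_mem_Ico_zpow hw hξ1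
  have hpos : ∀ n : ℤ, 0 < (ξ ^ 2) ^ n := fun n ↦ zpow_pos (by linarith) n
  refine ⟨toTransformation _ ⟨γη ^ (-n), Subgroup.zpow_mem _ h.mem _⟩, ?_, ?_⟩
  · simp only [hmem, toTransformation_smul]
    change _ ∧ _
    rw [h.norm_zpow_smul, zpow_neg, inv_mul_eq_div, le_div_iff₀ (hpos n), div_lt_iff₀ (hpos n)]
    refine ⟨by simpa using hn1, ?_⟩
    rw [zpow_add_one₀ (by linarith)] at hn2
    linarith
  · intro g hg
    obtain ⟨⟨γ, hγ⟩, rfl⟩ := toTransformation_surjective g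
    obtain ⟨n', hn'⟩ := h.generates γ hγ
    have hact : ∀ w : ℍ, γ • w = γη ^ n' • w := by
      rcases hn' with rfl | rfl <;> simp
    simp only [hmem, toTransformation_smul, hact] at hg
    obtain ⟨h1, h2⟩ := hg
    rw [h.norm_zpow_smul] at h1 h2
    have e : n' = -n := by
      have a1 : (ξ ^ 2) ^ (n' + n) < (ξ ^ 2) ^ (1 : ℤ) := by
        rw [zpow_add₀ (by linarith), zpow_one]
        exact (mul_le_mul_of_nonneg_left hn1 (hpos n').le).trans_lt h2
      have a2 : (ξ ^ 2) ^ (0 : ℤ) < (ξ ^ 2) ^ (n' + (n + 1)) := by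
        rw [zpow_add₀ (by linarith), zpow_zero]
        exact h1.trans_lt (mul_lt_mul_of_pos_left hn2 (hpos n'))
      rw [zpow_lt_zpow_iff_right₀ hξ1] at a1 a2
      omega
    refine transformation_ext fun w ↦ ?_
    simp [hact, e]

/-- The first factor is a power of `sin (arg w)`; the second is bounded above and below by positive
constants, as `arg w` is bounded. -/
theorem norm_hyperbolicPower {k : ℕ} (hk : Even k) (ξ : ℝ) (m : ℤ) (w : ℍ) :
    ‖hyperbolicPower k ξ m w‖ * w.im ^ (k / 2) =
      (w.im / ‖(w : ℂ)‖) ^ (k / 2) * Real.exp (-(Complex.arg w * (Real.pi * m / Real.log ξ))) := by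
  have hw : 0 < ‖(w : ℂ)‖ := norm_pos_iff.mpr w.ne_zero
  obtain ⟨j, rfl⟩ := hk
  have hj : (j + j) / 2 = j := by omega
  have hs : (-((j + j : ℕ) : ℂ) / 2 + Real.pi * Complex.I * m / Real.log ξ) =
      ((-(j : ℝ) : ℝ) : ℂ) + ((Real.pi * m / Real.log ξ : ℝ) : ℂ) * Complex.I := by
    push_cast; ring
  rw [hyperbolicPower, Complex.norm_cpow_of_ne_zero w.ne_zero, hs, hj]
  simp only [Complex.add_re, Complex.add_im, Complex.ofReal_re, Complex.ofReal_im,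
    Complex.re_ofReal_mul, Complex.im_ofReal_mul, Complex.I_re, Complex.I_im, mul_zero, add_zero,
    mul_one, zero_add]
  rw [Real.rpow_neg hw.le, Real.rpow_natCast, Real.exp_neg, div_pow]
  field_simp

theorem exp_bounds (ξ : ℝ) (m : ℤ) (w : ℍ) :
    Real.exp (-(Real.pi * |Real.pi * m / Real.log ξ|)) ≤
      Real.exp (-(Complex.arg w * (Real.pi * m / Real.log ξ))) ∧
    Real.exp (-(Complex.arg w * (Real.pi * m / Real.log ξ))) ≤
      Real.exp (Real.pi * |Real.pi * m / Real.log ξ|) := by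
  have h : |Complex.arg w * (Real.pi * m / Real.log ξ)| ≤ Real.pi * |Real.pi * m / Real.log ξ| := by
    rw [abs_mul]
    exact mul_le_mul_of_nonneg_right (Complex.abs_arg_le_pi _) (abs_nonneg _)
  rw [abs_le] at h
  constructor <;> rw [Real.exp_le_exp] <;> linarith

/-- `(y / |w|) ^ 2` is the product of the imaginary parts of `w` and `-1 / w`, and each of them
changes by at most the factor `exp (dist w w')`. -/
theorem im_div_norm_le_exp_dist (w w' : ℍ) :
    w.im / ‖(w : ℂ)‖ ≤ Real.exp (dist w w') * (w'.im / ‖(w' : ℂ)‖) := by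
  have hw : 0 < ‖(w : ℂ)‖ := norm_pos_iff.mpr w.ne_zero
  have hw' : 0 < ‖(w' : ℂ)‖ := norm_pos_iff.mpr w'.ne_zero
  let s : GL (Fin 2) ℝ := .mkOfDetNeZero !![0, -1; 1, 0] (by simp)
  have hs : s.det = 1 := by ext; simp [s]
  have hden : ∀ z : ℍ, (s • z).im = z.im / ‖(z : ℂ)‖ ^ 2 := by
    intro z
    rw [im_smul_of_det_eq_one hs]
    simp [denom, s]
  have h1 := im_le_im_mul_exp_dist w w'
  have h2 := im_le_im_mul_exp_dist (s • w) (s • w')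
  rw [dist_smul_smul_of_det_eq_one hs, hden, hden] at h2
  have h0 := w.im_pos
  have h0' := w'.im_pos
  apply le_of_sq_le_sq _ (by positivity)
  calc (w.im / ‖(w : ℂ)‖) ^ 2 = w.im * (w.im / ‖(w : ℂ)‖ ^ 2) := by ring
    _ ≤ (w'.im * Real.exp (dist w w')) * (w'.im / ‖(w' : ℂ)‖ ^ 2 * Real.exp (dist w w')) := by
        gcongr
    _ = (Real.exp (dist w w') * (w'.im / ‖(w' : ℂ)‖)) ^ 2 := by ring

/-- A Harnack inequality: since `Γ` acts by isometries, one constant serves all terms of the series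
when `z` is replaced by another point. -/
theorem exists_norm_hyperbolicPower_le {k : ℕ} (hk : Even k) (ξ : ℝ) (m : ℤ) (d : ℝ) :
    ∃ C : ℝ, ∀ w w' : ℍ, dist w w' ≤ d → ‖hyperbolicPower k ξ m w‖ * w.im ^ (k / 2) ≤
      C * (‖hyperbolicPower k ξ m w'‖ * w'.im ^ (k / 2)) := by
  set E := Real.exp (Real.pi * |Real.pi * m / Real.log ξ|) with hE
  refine ⟨Real.exp d ^ (k / 2) * (E * E), fun w w' hd ↦ ?_⟩
  rw [norm_hyperbolicPower hk, norm_hyperbolicPower hk]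
  have h1 := (exp_bounds ξ m w).2
  have h2 := (exp_bounds ξ m w').1
  rw [Real.exp_neg, ← hE] at h2
  have hE0 : 0 < E := Real.exp_pos _
  have h3 := (im_div_norm_le_exp_dist w w').trans (mul_le_mul_of_nonneg_right
    (Real.exp_le_exp.mpr hd) (div_nonneg w'.im_pos.le (norm_nonneg _)))
  have h0 := w.im_pos
  have h0' := w'.im_pos
  set e' := Real.exp (-(Complex.arg w' * (Real.pi * m / Real.log ξ)))
  have h4 : E ≤ E * E * e' := by
    rw [mul_assoc]
    refine le_mul_of_one_le_right hE0.le ?_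
    rwa [inv_le_iff_one_le_mul₀' hE0] at h2
  calc _ ≤ (Real.exp d * (w'.im / ‖(w' : ℂ)‖)) ^ (k / 2) * E := by gcongr
    _ ≤ (Real.exp d * (w'.im / ‖(w' : ℂ)‖)) ^ (k / 2) * (E * E * e') := by gcongr
    _ = _ := by rw [mul_pow]; ring

theorem continuous_hyperbolicPower (k : ℕ) (ξ : ℝ) (m : ℤ) : Continuous (hyperbolicPower k ξ m) := by
  unfold hyperbolicPower
  refine continuous_coe.cpow continuous_const fun w ↦ ?_
  right
  rw [coe_im]
  exact w.im_ne_zero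

theorem norm_hyperbolicPower_le_of_mem {k : ℕ} (hk : Even k) (hk4 : 4 ≤ k) (ξ : ℝ) (m : ℤ) {w : ℍ}
    (hw : 1 ≤ ‖(w : ℂ)‖) : ‖hyperbolicPower k ξ m w‖ * w.im ^ (k / 2) ≤
      Real.exp (Real.pi * |Real.pi * m / Real.log ξ|) * w.im ^ 2 := by
  rw [norm_hyperbolicPower hk, mul_comm]
  have h0 := w.im_pos
  have h1 : w.im / ‖(w : ℂ)‖ ≤ 1 := by
    rw [div_le_one (by linarith)]
    exact (le_abs_self _).trans (Complex.abs_im_le_norm w)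
  have h2 : w.im / ‖(w : ℂ)‖ ≤ w.im := div_le_self h0.le hw
  gcongr
  · exact Real.exp_le_exp.mp (exp_bounds ξ m w).2
  · calc (w.im / ‖(w : ℂ)‖) ^ (k / 2) ≤ (w.im / ‖(w : ℂ)‖) ^ 2 :=
        pow_le_pow_of_le_one (by positivity) h1 (by omega)
      _ ≤ w.im ^ 2 := by gcongr

/-- The factor `y ^ 2` cancels the hyperbolic density, leaving the Euclidean area of a bounded
region. -/
theorem lintegral_im_sq_halfAnnulus_lt_top (ξ : ℝ) :
    ∫⁻ w in halfAnnulus ξ, ENNReal.ofReal (w.im ^ 2) < ⊤ := by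
  have hm := measurableSet_halfAnnulus ξ
  have hd : Measurable fun z : ℍ ↦ ((1 / NNReal.mk z.im z.im_pos.le : NNReal) ^ 2) := by
    have : Continuous fun z : ℍ ↦ ((1 / NNReal.mk z.im z.im_pos.le : NNReal) ^ 2) := by
      refine .pow (.div₀ continuous_const ?_ ?_) _
      · exact continuous_im.subtype_mk _
      · exact fun x ↦ NNReal.ne_iff.mp x.im_ne_zero
    exact this.measurable
  rw [volume_def, setLIntegral_withDensity_eq_setLIntegral_mul _ (by fun_prop)
    (by have := continuous_im.measurable; fun_prop) hm]
  have : ∀ w : ℍ, (((1 / NNReal.mk w.im w.im_pos.le : NNReal) ^ 2 : NNReal) : ENNReal) *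
      ENNReal.ofReal (w.im ^ 2) = 1 := by
    intro w
    have : ENNReal.ofReal (w.im ^ 2) = ((NNReal.mk w.im w.im_pos.le ^ 2 : NNReal) : ENNReal) := by
      rw [ENNReal.ofReal_eq_coe_nnreal (sq_nonneg _)]
      rfl
    rw [this, ← ENNReal.coe_mul, ← mul_pow, one_div, inv_mul_cancel₀, one_pow, ENNReal.coe_one]
    exact NNReal.ne_iff.mp w.im_ne_zero
  simp only [Pi.mul_apply, this, lintegral_one, Measure.restrict_apply_univ]
  rw [measurableEmbedding_coe.comap_apply]
  refine (measure_mono ?_).trans_lt (measure_ball_lt_top (x := (0 : ℂ)) (r := ξ ^ 2))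
  rintro _ ⟨w, hw, rfl⟩
  simpa using hw.2

theorem integrableOn_halfAnnulus {k : ℕ} (hk : Even k) (hk4 : 4 ≤ k) (ξ : ℝ) (m : ℤ) :
    IntegrableOn (fun w ↦ ‖hyperbolicPower k ξ m w‖ * w.im ^ (k / 2)) (halfAnnulus ξ) := by
  refine ⟨((continuous_hyperbolicPower k ξ m).norm.mul
    (continuous_im.pow _)).aestronglyMeasurable, ?_⟩
  set E := Real.exp (Real.pi * |Real.pi * m / Real.log ξ|) with hE
  calc ∫⁻ w in halfAnnulus ξ, ‖‖hyperbolicPower k ξ m w‖ * w.im ^ (k / 2)‖ₑ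
      ≤ ∫⁻ w in halfAnnulus ξ, ENNReal.ofReal E * ENNReal.ofReal (w.im ^ 2) := by
        refine setLIntegral_mono' (measurableSet_halfAnnulus ξ) fun w hw ↦ ?_
        have h0 := w.im_pos
        rw [← ENNReal.ofReal_mul (Real.exp_pos _).le, Real.enorm_of_nonneg (by positivity)]
        exact ENNReal.ofReal_le_ofReal (norm_hyperbolicPower_le_of_mem hk hk4 ξ m hw.1)
    _ = ENNReal.ofReal E * ∫⁻ w in halfAnnulus ξ, ENNReal.ofReal (w.im ^ 2) :=
        lintegral_const_mul' _ _ ENNReal.ofReal_ne_top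
    _ < ⊤ := ENNReal.mul_lt_top ENNReal.ofReal_lt_top (lintegral_im_sq_halfAnnulus_lt_top ξ)

end

/-! ### Convergence of the hyperbolic Poincaré series and unfolding of the inner product -/

section

variable {Γ : Subgroup (GL (Fin 2) ℝ)} {η₁ η₂ : OnePoint ℝ} {γη σ : GL (Fin 2) ℝ} {ξ : ℝ}

theorem isScalarMatrix_of_smul_eq {g : GL (Fin 2) ℝ} (hg : g.det = 1) (h : ∀ z : ℍ, g • z = z) :
    IsScalarMatrix g.val := by
  have key : ∀ z : ℍ, (g 0 0 : ℂ) * z + g 0 1 = z * (g 1 0 * z + g 1 1) := by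
    intro z
    have h1 := congrArg (fun z : ℍ ↦ (z : ℂ)) (h z)
    simp only [coe_smul_of_det_pos (show 0 < g.det.val by rw [hg]; simp)] at h1
    rwa [div_eq_iff (denom_ne_zero g z)] at h1
  have h1 := key ⟨Complex.I, by simp⟩
  have h2 := key ⟨2 * Complex.I, by simp⟩
  have a1 := congrArg Complex.re h1
  have a2 := congrArg Complex.im h1
  have a3 := congrArg Complex.re h2
  simp at a1 a2 a3
  refine ⟨?_, ?_, ?_⟩ <;> linarith

theorem smul_onePoint_eq_of_isScalarMatrix {g : GL (Fin 2) ℝ} (h : IsScalarMatrix g.val)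
    (x : OnePoint ℝ) : g • x = x := by
  obtain ⟨h1, h2, h3⟩ := h
  have h0 : g 1 1 ≠ 0 := by
    intro h0
    apply g.det.ne_zero
    rw [Matrix.GeneralLinearGroup.val_det_apply, Matrix.det_fin_two, h1, h2, h0]
    simp
  induction x with
  | infty => rw [OnePoint.smul_infty_eq_ite, if_pos h2]
  | coe x =>
    rw [OnePoint.smul_some_eq_ite, if_neg (by simp [h2, h0])]
    rw [h1, h2, h3]
    congr 1
    rw [add_zero, zero_mul, zero_add, mul_div_cancel_left₀ _ h0]

theorem pairStabilizer_le : pairStabilizer Γ η₁ η₂ ≤ Γ := fun _ h ↦ h.1.1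

theorem mem_pairStabilizer_of_smul_eq [Γ.HasDetOne] (γ : GL (Fin 2) ℝ) (hγ : γ ∈ Γ)
    (h : ∀ z : ℍ, γ • z = z) : γ ∈ pairStabilizer Γ η₁ η₂ := by
  have := isScalarMatrix_of_smul_eq (Subgroup.HasDetOne.det_eq hγ) h
  exact ⟨⟨hγ, smul_onePoint_eq_of_isScalarMatrix this _⟩, smul_onePoint_eq_of_isScalarMatrix this _⟩

instance [Γ.HasDetOne] [DiscreteTopology Γ] :
    Countable (transformationGroup (pairStabilizer Γ η₁ η₂)) := by
  have : Countable (pairStabilizer Γ η₁ η₂) :=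
    (Subgroup.inclusion_injective (pairStabilizer_le (Γ := Γ) (η₁ := η₁) (η₂ := η₂))).countable
  exact toTransformation_surjective.countable

theorem IsHyperbolicScaling.not_isScalarMatrix (h : IsHyperbolicScaling Γ η₁ η₂ γη σ ξ) :
    ∃ B ∈ Γ, ¬ IsScalarMatrix B.val := by
  refine ⟨γη, pairStabilizer_le h.mem, fun hs ↦ ?_⟩
  have hξ0 : 0 < ξ := one_pos.trans h.one_lt
  obtain ⟨c, hc⟩ : ∃ c : ℝ, γη.val = c • (1 : Matrix (Fin 2) (Fin 2) ℝ) := by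
    obtain ⟨h1, h2, h3⟩ := hs
    refine ⟨γη 0 0, ?_⟩
    ext i j
    fin_cases i <;> fin_cases j <;> simp [h1, h2, h3]
  have : (σ⁻¹ * γη * σ).val = c • (1 : Matrix (Fin 2) (Fin 2) ℝ) := by
    have e : (σ⁻¹ * γη * σ).val = (σ⁻¹).val * γη.val * σ.val := rfl
    rw [e, hc, Matrix.mul_smul, mul_one, Matrix.smul_mul]
    congr 1
    rw [← Units.val_mul]
    simp
  have hξ : ξ = ξ⁻¹ := by
    rcases h.conj with hc | hc <;> rw [this] at hc
    · have h1 := congrFun₂ hc 0 0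
      have h2 := congrFun₂ hc 1 1
      simp at h1 h2
      linarith
    · have h1 := congrFun₂ hc 0 0
      have h2 := congrFun₂ hc 1 1
      simp at h1 h2
      linarith
  have := inv_lt_one_of_one_lt₀ h.one_lt
  have := h.one_lt
  linarith

theorem det_inv_eq_one {g : GL (Fin 2) ℝ} (hg : g.det = 1) : g⁻¹.det = 1 := by simp [hg]

/-- The `Γ_η`-invariant function `‖φ‖ y ^ (k / 2)` for the seed `φ` of the hyperbolic Poincaré series. -/
theorem norm_hyperbolicSeed_mul {k : ℕ} (hk : Even k) (hσ : σ.det = 1) (m : ℤ) (z : ℍ) :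
    ‖hyperbolicSeed k σ ξ m z‖ * z.im ^ (k / 2) =
      ‖hyperbolicPower k ξ m (σ⁻¹ • z)‖ * (σ⁻¹ • z).im ^ (k / 2) :=
  norm_slash_mul_im_pow hk _ (det_inv_eq_one hσ) z

theorem norm_hyperbolicSeed_smul [Γ.HasDetOne] (h : IsHyperbolicScaling Γ η₁ η₂ γη σ ξ) {k : ℕ}
    (hk : Even k) (m : ℤ) {γ : GL (Fin 2) ℝ} (hγ : γ ∈ pairStabilizer Γ η₁ η₂) (z : ℍ) :
    ‖hyperbolicSeed k σ ξ m (γ • z)‖ * (γ • z).im ^ (k / 2) =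
      ‖hyperbolicSeed k σ ξ m z‖ * z.im ^ (k / 2) := by
  rw [← norm_slash_mul_im_pow hk _ (Subgroup.HasDetOne.det_eq (pairStabilizer_le hγ)),
    hyperbolicSeed_slash h hk m hγ]

theorem integrableOn_smul_iff {E : Type*} [NormedAddCommGroup E] (g : GL (Fin 2) ℝ) (S : Set ℍ)
    (ψ : ℍ → E) : IntegrableOn ψ (g • S) ↔ IntegrableOn (fun z ↦ ψ (g • z)) S :=
  (measurePreserving_smul g (volume : Measure ℍ)).integrableOn_image (measurableEmbedding_const_smul g)

theorem setIntegral_smul_set {E : Type*} [NormedAddCommGroup E] [NormedSpace ℝ E]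
    (g : GL (Fin 2) ℝ) (S : Set ℍ) (ψ : ℍ → E) : ∫ z in g • S, ψ z = ∫ z in S, ψ (g • z) :=
  (measurePreserving_smul g (volume : Measure ℍ)).setIntegral_image_emb
    (measurableEmbedding_const_smul g) ψ S

theorem integrableOn_norm_hyperbolicSeed {k : ℕ} (hk : Even k) (hk4 : 4 ≤ k) (hσ : σ.det = 1) (m : ℤ) :
    IntegrableOn (fun z ↦ ‖hyperbolicSeed k σ ξ m z‖ * z.im ^ (k / 2)) (σ • halfAnnulus ξ) := by
  rw [integrableOn_smul_iff]
  simp only [norm_hyperbolicSeed_mul hk hσ, inv_smul_smul]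
  exact integrableOn_halfAnnulus hk hk4 ξ m

theorem norm_relPoincareTerm_mul [Γ.HasDetOne] {Γ₀ : Subgroup (GL (Fin 2) ℝ)} {k : ℕ} (hk : Even k)
    (φ : ℍ → ℂ) (q : RightCosets Γ Γ₀) (z : ℍ) :
    ‖relPoincareTerm Γ Γ₀ k φ q z‖ * z.im ^ (k / 2) =
      ‖φ ((q.out : GL (Fin 2) ℝ) • z)‖ * ((q.out : GL (Fin 2) ℝ) • z).im ^ (k / 2) :=
  norm_slash_mul_im_pow hk _ (Subgroup.HasDetOne.det_eq q.out.2) z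

section Unfolding

variable [Γ.HasDetOne] [DiscreteTopology Γ] {D : Set ℍ}
  (hD : IsFundamentalDomain (transformationGroup Γ) D) (h : IsHyperbolicScaling Γ η₁ η₂ γη σ ξ)
  {k : ℕ} (hk4 : 4 ≤ k) (hk : Even k) (m : ℤ)
include hD h hk4 hk

theorem summable_norm_relPoincareTerm (z : ℍ) :
    Summable fun q : RightCosets Γ (pairStabilizer Γ η₁ η₂) ↦
      ‖relPoincareTerm Γ (pairStabilizer Γ η₁ η₂) k (hyperbolicSeed k σ ξ m) q z‖ := by
  set v : ℍ → ℝ := fun z ↦ ‖hyperbolicSeed k σ ξ m z‖ * z.im ^ (k / 2) with hv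
  have hv0 : ∀ z, 0 ≤ v z := fun z ↦ mul_nonneg (norm_nonneg _) (pow_nonneg z.im_pos.le _)
  -- Unfolding the weighted norm of the seed, cast to `ℂ`, gives absolute convergence almost
  -- everywhere on `D`. As `D` has positive measure, some point `w` of convergence exists, and the
  -- Harnack inequality transfers convergence to `z`.
  have hu := (unfolding (ψ := fun z ↦ (v z : ℂ)) pairStabilizer_le mem_pairStabilizer_of_smul_eq hD
    h.isFundamentalDomain
    (fun γ hγ z ↦ congrArg Complex.ofReal (norm_hyperbolicSeed_smul h hk m hγ z))
    (integrableOn_norm_hyperbolicSeed hk hk4 h.det_eq_one m).ofReal).1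
  have hne : volume D ≠ 0 := by
    refine hD.measure_ne_zero ?_
    exact fun h0 ↦ (volume_ball_pos I one_pos).ne' (by rw [h0]; rfl)
  have : (ae (volume.restrict D)).NeBot := ae_restrict_neBot.mpr hne
  obtain ⟨w, hw⟩ := hu.exists
  obtain ⟨C, hC⟩ := exists_norm_hyperbolicPower_le hk ξ m (dist z w)
  have hy : 0 < z.im ^ (k / 2) := pow_pos z.im_pos _
  refine Summable.of_nonneg_of_le (fun _ ↦ norm_nonneg _) (fun q ↦ ?_)
    ((hw.mul_left C).mul_right (z.im ^ (k / 2))⁻¹)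
  rw [← div_eq_mul_inv, le_div_iff₀ hy, norm_relPoincareTerm_mul hk, Complex.norm_real,
    Real.norm_of_nonneg (hv0 _), hv]
  simp only [norm_hyperbolicSeed_mul hk h.det_eq_one]
  refine hC _ _ ?_
  rw [dist_smul_smul_of_det_eq_one (det_inv_eq_one h.det_eq_one),
    dist_smul_smul_of_det_eq_one (Subgroup.HasDetOne.det_eq q.out.2)]

theorem integrableOn_and_peterssonInner_eq (hV : volume D < ⊤) (f : CuspForm Γ k) :
    IntegrableOn (peterssonIntegrand k f (hyperbolicPoincare Γ η₁ η₂ k σ ξ m)) D ∧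
    IntegrableOn (peterssonIntegrand k ((f : ℍ → ℂ) ∣[(k : ℤ)] σ) (hyperbolicPower k ξ m))
      (halfAnnulus ξ) ∧
    peterssonInner k D f (hyperbolicPoincare Γ η₁ η₂ k σ ξ m) =
      ∫ w in halfAnnulus ξ,
        peterssonIntegrand k ((f : ℍ → ℂ) ∣[(k : ℤ)] σ) (hyperbolicPower k ξ m) w := by
  obtain ⟨C, hC⟩ := exists_bound_of_finite_covolume hD hV h.not_isScalarMatrix hk f
  set φ := hyperbolicSeed k σ ξ m with hφ
  set ψ := peterssonIntegrand k f φ with hψ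
  have hfs : ∀ γ ∈ Γ, (f : ℍ → ℂ) ∣[(k : ℤ)] γ = f := fun γ hγ ↦ f.slash_action_eq' γ hγ
  have hterm : ∀ (γ : GL (Fin 2) ℝ), γ ∈ Γ → ∀ z,
      peterssonIntegrand k f (φ ∣[(k : ℤ)] γ) z = ψ (γ • z) := by
    intro γ hγ z
    conv_lhs => rw [← hfs γ hγ]
    exact peterssonIntegrand_slash _ _ (Subgroup.HasDetOne.det_eq hγ) z
  have hφσ : ∀ z, ψ (σ • z) =
      peterssonIntegrand k ((f : ℍ → ℂ) ∣[(k : ℤ)] σ) (hyperbolicPower k ξ m) z := by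
    intro z
    rw [hψ, ← peterssonIntegrand_slash _ _ h.det_eq_one, hφ, hyperbolicSeed, ← SlashAction.slash_mul]
    simp
  have hψinv : ∀ γ ∈ pairStabilizer Γ η₁ η₂, ∀ z, ψ (γ • z) = ψ z := by
    intro γ hγ z
    rw [← hterm γ (pairStabilizer_le hγ), hyperbolicSeed_slash h hk m hγ]
  have hcont : Continuous φ := by
    have : φ = fun z ↦ hyperbolicPower k ξ m (σ⁻¹ • z) * denom σ⁻¹ z ^ (-(k : ℤ)) :=
      funext fun z ↦ slash_apply_of_det_eq_one _ _ (det_inv_eq_one h.det_eq_one) z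
    rw [this]
    refine ((continuous_hyperbolicPower k ξ m).comp (continuous_const_smul _)).mul ?_
    refine Continuous.zpow₀ ?_ _ fun z ↦ Or.inl (denom_ne_zero _ z)
    unfold denom
    exact (continuous_const.mul continuous_coe).add continuous_const
  have hfc : Continuous f := f.holo'.continuous
  have hψc : Continuous ψ := by
    rw [hψ]
    unfold peterssonIntegrand
    exact (hfc.mul (Complex.continuous_conj.comp hcont)).mul
      ((Complex.continuous_ofReal.comp continuous_im).pow _)
  -- The weighted norm of `f` is at most `C`, and that of the seed is integrable on the domain of
  -- `Γ_η`.
  have hint : IntegrableOn ψ (σ • halfAnnulus ξ) := by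
    refine Integrable.mono' ((integrableOn_norm_hyperbolicSeed (ξ := ξ) hk hk4 h.det_eq_one m).const_mul C)
      hψc.aestronglyMeasurable (Filter.Eventually.of_forall fun z ↦ ?_)
    rw [hψ, norm_peterssonIntegrand hk]
    exact mul_le_mul_of_nonneg_right (hC z) (mul_nonneg (norm_nonneg _) (pow_nonneg z.im_pos.le _))
  obtain ⟨-, h2, h3⟩ := unfolding pairStabilizer_le mem_pairStabilizer_of_smul_eq hD
    h.isFundamentalDomain hψinv hint
  have hsum : ∀ z, peterssonIntegrand k f (hyperbolicPoincare Γ η₁ η₂ k σ ξ m) z =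
      ∑' q : RightCosets Γ (pairStabilizer Γ η₁ η₂), ψ ((q.out : GL (Fin 2) ℝ) • z) := by
    intro z
    have hs := (summable_norm_relPoincareTerm hD h hk4 hk m z).of_norm.hasSum
    have hs' := ((hs.map (starRingEnd ℂ) Complex.continuous_conj).mul_left (f z)).mul_right
      ((z.im : ℂ) ^ k)
    rw [peterssonIntegrand, hyperbolicPoincare, relPoincare, ← hs'.tsum_eq]
    exact tsum_congr fun q ↦ hterm _ q.out.2 z
  refine ⟨?_, ?_, ?_⟩
  · rwa [show peterssonIntegrand k f (hyperbolicPoincare Γ η₁ η₂ k σ ξ m) = _ from funext hsum]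
  · rw [integrableOn_smul_iff] at hint
    simpa only [hφσ] using hint
  · rw [peterssonInner, funext hsum, h3, setIntegral_smul_set]
    simp only [hφσ]

end Unfolding

end

/-! ### Logarithmic polar coordinates on the half annulus -/

theorem integrableOn_and_setIntegral_image_coe {E : Type*} [NormedAddCommGroup E] [NormedSpace ℝ E]
    {S : Set ℍ} (hS : MeasurableSet S) {G : ℍ → E} (hG : IntegrableOn G S) :
    IntegrableOn (fun z : ℂ ↦ (z.im ^ 2)⁻¹ • G (ofComplex z)) ((↑) '' S) ∧
    ∫ z in ((↑) '' S : Set ℂ), (z.im ^ 2)⁻¹ • G (ofComplex z) = ∫ w in S, G w := by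
  have hd : Measurable fun z : ℍ ↦ ((1 / NNReal.mk z.im z.im_pos.le : NNReal) ^ 2) := by
    have : Continuous fun z : ℍ ↦ ((1 / NNReal.mk z.im z.im_pos.le : NNReal) ^ 2) := by
      refine .pow (.div₀ continuous_const ?_ ?_) _
      · exact continuous_im.subtype_mk _
      · exact fun x ↦ NNReal.ne_iff.mp x.im_ne_zero
    exact this.measurable
  have hmp : MeasurePreserving UpperHalfPlane.coe (volume.comap UpperHalfPlane.coe)
      (volume.restrict (.range UpperHalfPlane.coe)) :=
    ⟨measurable_coe, by rw [measurableEmbedding_coe.map_comap]⟩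
  have hr : (volume.restrict (.range UpperHalfPlane.coe)).restrict (UpperHalfPlane.coe '' S) =
      volume.restrict (UpperHalfPlane.coe '' S) := by
    rw [Measure.restrict_restrict (measurableEmbedding_coe.measurableSet_image.mpr hS),
      Set.inter_eq_self_of_subset_left (Set.image_subset_range _ _)]
  have he : ∀ w : ℍ, (((w : ℂ).im ^ 2)⁻¹ • G (ofComplex (w : ℂ))) =
      ((1 / NNReal.mk w.im w.im_pos.le : NNReal) ^ 2) • G w := by
    intro w
    rw [ofComplex_apply, NNReal.smul_def]
    congr 1
    simp
  have h1 := hmp.integrableOn_image measurableEmbedding_coe (s := S)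
    (f := fun z : ℂ ↦ (z.im ^ 2)⁻¹ • G (ofComplex z))
  have h2 := hmp.setIntegral_image_emb measurableEmbedding_coe
    (fun z : ℂ ↦ (z.im ^ 2)⁻¹ • G (ofComplex z)) S
  rw [IntegrableOn, hr] at h1
  rw [hr] at h2
  refine ⟨h1.mpr ?_, h2.trans ?_⟩
  · rw [IntegrableOn, volume_def, restrict_withDensity hS,
      integrable_withDensity_iff_integrable_smul hd] at hG
    refine hG.congr (Filter.Eventually.of_forall fun w ↦ ?_)
    exact (he w).symm
  · rw [volume_def, setIntegral_withDensity_eq_setIntegral_smul hd _ hS]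
    exact integral_congr_ae (Filter.Eventually.of_forall he)

theorem Complex.det_restrictScalars_smul (c : ℂ) :
    ((ContinuousLinearMap.toSpanSingleton ℂ c).restrictScalars ℝ : ℂ →L[ℝ] ℂ).det = ‖c‖ ^ 2 := by
  rw [← Complex.normSq_eq_norm_sq, ← Algebra.norm_complex_apply, Algebra.norm_apply]
  rw [ContinuousLinearMap.det]
  congr 1
  ext
  simp [mul_comm]

/-- The point `exp (t + i θ)` of the upper half plane, for `0 < θ < π`. -/
def expPoint (t θ : ℝ) : ℍ := ofComplex (Complex.exp (t + θ * Complex.I))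

theorem im_exp_pos {t θ : ℝ} (hθ : θ ∈ Set.Ioo 0 Real.pi) :
    0 < (Complex.exp (t + θ * Complex.I)).im := by
  rw [Complex.exp_im]
  simp only [Complex.add_re, Complex.ofReal_re, Complex.mul_re, Complex.I_re, Complex.ofReal_im,
    Complex.I_im, Complex.add_im, Complex.mul_im]
  have := Real.sin_pos_of_mem_Ioo hθ
  simp only [mul_zero, sub_zero, mul_one, add_zero, zero_add]
  positivity

theorem coe_expPoint {t θ : ℝ} (hθ : θ ∈ Set.Ioo 0 Real.pi) :
    (expPoint t θ : ℂ) = Complex.exp (t + θ * Complex.I) :=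
  congrArg UpperHalfPlane.coe (ofComplex_apply_of_im_pos (im_exp_pos hθ))

/-- For `w = exp (t + i θ)` the Jacobian is `|w| ^ 2` and `y = |w| sin θ`, so `dx dy / y²` becomes
`dt dθ / sin² θ`. -/
theorem integrableOn_and_setIntegral_halfAnnulus {G : ℍ → ℂ} {ξ : ℝ} (hξ : 1 < ξ)
    (hG : IntegrableOn G (halfAnnulus ξ)) :
    IntegrableOn (fun p : ℝ × ℝ ↦ (Real.sin p.2 ^ 2)⁻¹ • G (expPoint p.1 p.2))
      (Set.Ico 0 (2 * Real.log ξ) ×ˢ Set.Ioo 0 Real.pi) ∧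
    ∫ p in Set.Ico 0 (2 * Real.log ξ) ×ˢ Set.Ioo 0 Real.pi,
      (Real.sin p.2 ^ 2)⁻¹ • G (expPoint p.1 p.2) = ∫ w in halfAnnulus ξ, G w := by
  have hξ0 : 0 < ξ := by linarith
  set R : Set (ℝ × ℝ) := Set.Ico 0 (2 * Real.log ξ) ×ˢ Set.Ioo 0 Real.pi with hR
  have hRm : MeasurableSet R := measurableSet_Ico.prod measurableSet_Ioo
  obtain ⟨h1, h2⟩ := integrableOn_and_setIntegral_image_coe (measurableSet_halfAnnulus ξ) hG
  rw [← h2]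
  set F : ℂ → ℂ := fun z : ℂ ↦ (z.im ^ 2)⁻¹ • G (ofComplex z)
  set e := Complex.measurableEquivRealProd
  set R' : Set ℂ := e ⁻¹' R with hR'
  have hR'm : MeasurableSet R' := e.measurable hRm
  have himage : (UpperHalfPlane.coe '' halfAnnulus ξ) = Complex.exp '' R' := by
    ext z
    constructor
    · rintro ⟨w, ⟨hw1, hw2⟩, rfl⟩
      refine ⟨Complex.log w, ⟨⟨?_, ?_⟩, ?_, ?_⟩, Complex.exp_log w.ne_zero⟩
      · simpa [e, Complex.log_re] using Real.log_nonneg hw1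
      · have := Real.log_lt_log (by linarith) hw2
        rw [Real.log_pow] at this
        simpa [e, Complex.log_re] using this
      · have := Complex.arg_nonneg_iff.mpr w.im_pos.le
        refine lt_of_le_of_ne (by simpa [e, Complex.log_im] using this) fun h0 ↦ ?_
        have h0' : Complex.arg w = 0 := by simpa [e, Complex.log_im] using h0.symm
        exact w.im_pos.ne' (Complex.arg_eq_zero_iff.mp h0').2
      · refine lt_of_le_of_ne (by simpa [e, Complex.log_im] using Complex.arg_le_pi _) fun h0 ↦ ?_
        have h0' : Complex.arg w = Real.pi := by simpa [e, Complex.log_im] using h0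
        exact w.im_pos.ne' (Complex.arg_eq_pi_iff.mp h0').2
    · rintro ⟨u, ⟨⟨hu1, hu2⟩, hu3⟩, rfl⟩
      have hu : u = ((u.re : ℝ) : ℂ) + (u.im : ℝ) * Complex.I := (Complex.re_add_im u).symm
      have hu3' : u.im ∈ Set.Ioo 0 Real.pi := hu3
      have hu1' : 0 ≤ u.re := hu1
      have hu2' : u.re < 2 * Real.log ξ := hu2
      refine ⟨expPoint u.re u.im, ?_, ?_⟩
      · change _ ∧ _
        rw [coe_expPoint hu3', ← hu, Complex.norm_exp]
        refine ⟨Real.one_le_exp hu1', ?_⟩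
        calc Real.exp u.re < Real.exp (2 * Real.log ξ) := Real.exp_lt_exp.mpr hu2'
          _ = ξ ^ 2 := by
            rw [two_mul, Real.exp_add, Real.exp_log hξ0, sq]
      · rw [coe_expPoint hu3', ← hu]
  have hinj : Set.InjOn Complex.exp R' := by
    intro u hu v hv huv
    have a1 : u.im ∈ Set.Ioo 0 Real.pi := hu.2
    have a2 : v.im ∈ Set.Ioo 0 Real.pi := hv.2
    have := Real.pi_pos
    exact Complex.exp_inj_of_neg_pi_lt_of_le_pi (by linarith [a1.1]) a1.2.le (by linarith [a2.1])
      a2.2.le huv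
  have hderiv : ∀ u ∈ R', HasFDerivWithinAt Complex.exp
      ((ContinuousLinearMap.toSpanSingleton ℂ (Complex.exp u)).restrictScalars ℝ : ℂ →L[ℝ] ℂ) R' u :=
    fun u _ ↦ ((Complex.hasDerivAt_exp u).hasFDerivAt.restrictScalars ℝ).hasFDerivWithinAt
  rw [himage] at h1 ⊢
  rw [integrableOn_image_iff_integrableOn_abs_det_fderiv_smul volume hR'm hderiv hinj] at h1
  rw [integral_image_eq_integral_abs_det_fderiv_smul volume hR'm hderiv hinj]
  have hcongr : Set.EqOn (fun u : ℂ ↦ |((ContinuousLinearMap.toSpanSingleton ℂ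
      (Complex.exp u)).restrictScalars ℝ : ℂ →L[ℝ] ℂ).det| • F (Complex.exp u))
      (fun u ↦ (fun p : ℝ × ℝ ↦ (Real.sin p.2 ^ 2)⁻¹ • G (expPoint p.1 p.2)) (e u)) R' := by
    intro u hu
    have hsin := Real.sin_pos_of_mem_Ioo (show u.im ∈ Set.Ioo 0 Real.pi from hu.2)
    have hu' : ((u.re : ℝ) : ℂ) + (u.im : ℝ) * Complex.I = u := Complex.re_add_im u
    have he1 : (e u).1 = u.re := rfl
    have he2 : (e u).2 = u.im := rfl
    simp only [F, Complex.det_restrictScalars_smul, he1, he2, expPoint, hu']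
    rw [smul_smul]
    congr 1
    rw [Complex.norm_exp, Complex.exp_im, abs_of_nonneg (by positivity)]
    have := Real.exp_pos u.re
    field_simp
  have hmp := Complex.volume_preserving_equiv_real_prod
  rw [integrableOn_congr_fun hcongr hR'm] at h1
  rw [setIntegral_congr_fun hR'm hcongr]
  constructor
  · exact (hmp.integrableOn_comp_preimage e.measurableEmbedding).mp h1
  · exact (hmp.setIntegral_preimage_emb e.measurableEmbedding _ _).symm

/-! ### Orthogonality of the terms of the hyperbolic expansion -/

section

theorem hyperbolicPower_expPoint (k : ℕ) (ξ : ℝ) (m : ℤ) {t θ : ℝ} (hθ : θ ∈ Set.Ioo 0 Real.pi) :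
    hyperbolicPower k ξ m (expPoint t θ) = Complex.exp ((t + θ * Complex.I) *
      (-(k : ℂ) / 2 + Real.pi * Complex.I * m / Real.log ξ)) := by
  rw [hyperbolicPower, coe_expPoint hθ, Complex.cpow_def_of_ne_zero (Complex.exp_ne_zero _),
    Complex.log_exp]
  · simpa using by linarith [hθ.1, Real.pi_pos]
  · simpa using hθ.2.le

theorem im_expPoint {t θ : ℝ} (hθ : θ ∈ Set.Ioo 0 Real.pi) :
    (expPoint t θ).im = Real.exp t * Real.sin θ := by
  rw [← coe_im, coe_expPoint hθ, Complex.exp_im]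
  simp

/-- The factor `exp (-k t)` from the two powers cancels against `y ^ k`, so `t` survives only in a
phase. -/
theorem hyperbolicPower_mul_conj_expPoint (k : ℕ) (ξ : ℝ) (l m : ℤ) {t θ : ℝ}
    (hθ : θ ∈ Set.Ioo 0 Real.pi) :
    hyperbolicPower k ξ l (expPoint t θ) *
        (starRingEnd ℂ) (hyperbolicPower k ξ m (expPoint t θ)) * ((expPoint t θ).im : ℂ) ^ k =
      ((Real.exp (-(Real.pi * (l + m) * θ / Real.log ξ)) * Real.sin θ ^ k : ℝ) : ℂ) *
        Complex.exp (Complex.I * (Real.pi * (l - m) / Real.log ξ) * t) := by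
  rw [hyperbolicPower_expPoint _ _ _ hθ, hyperbolicPower_expPoint _ _ _ hθ, im_expPoint hθ,
    ← Complex.exp_conj]
  have hc : (starRingEnd ℂ) ((t + θ * Complex.I) *
      (-(k : ℂ) / 2 + Real.pi * Complex.I * m / Real.log ξ)) = (t - θ * Complex.I) *
      (-(k : ℂ) / 2 - Real.pi * Complex.I * m / Real.log ξ) := by
    simp only [map_mul, map_add, map_div₀, Complex.conj_ofReal, Complex.conj_I, map_neg, map_intCast,
      map_natCast, map_ofNat]
    ring
  rw [hc]
  push_cast
  rw [mul_pow, ← Complex.exp_nat_mul, ← Complex.exp_add, ← mul_assoc, ← Complex.exp_add,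
    mul_right_comm (Complex.exp (-_)), ← Complex.exp_add]
  congr 2
  linear_combination (θ * (Real.pi * (l + m) / Real.log ξ) : ℂ) * Complex.I_sq

theorem integral_exp_eq_ite {ξ : ℝ} (hξ : 1 < ξ) (l m : ℤ) :
    ∫ t in (0 : ℝ)..2 * Real.log ξ,
      Complex.exp (Complex.I * (Real.pi * (l - m) / Real.log ξ) * t) =
      if l = m then 2 * (Real.log ξ : ℂ) else 0 := by
  have hlog : (Real.log ξ : ℂ) ≠ 0 := by exact_mod_cast (Real.log_pos hξ).ne'
  split_ifs with h
  · subst h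
    simp
  · have hlm : (l : ℂ) - m ≠ 0 := sub_ne_zero.mpr (by exact_mod_cast h)
    have hpi : (Real.pi : ℂ) ≠ 0 := by exact_mod_cast Real.pi_ne_zero
    rw [integral_exp_mul_complex
      (mul_ne_zero Complex.I_ne_zero (div_ne_zero (mul_ne_zero hpi hlm) hlog))]
    have e : Complex.I * (Real.pi * (l - m) / Real.log ξ) * ((2 * Real.log ξ : ℝ) : ℂ) =
        ((l - m : ℤ) : ℂ) * (2 * Real.pi * Complex.I) := by
      push_cast
      field_simp
    rw [e, Complex.exp_int_mul_two_pi_mul_I]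
    simp

variable {k : ℕ} {ξ : ℝ} {F : ℍ → ℂ} {b : ℤ → ℂ}

/-- For fixed `θ` the modulus of each term is independent of `t`. Absolute summability at `t = 0`
therefore dominates the whole ray, the expansion may be integrated termwise, and orthogonality
leaves `l = m`. -/
theorem integral_peterssonIntegrand_expPoint (hξ : 1 < ξ)
    (hb : ∀ w, HasSum (fun l ↦ b l * hyperbolicPower k ξ l w) (F w)) (m : ℤ) {θ : ℝ}
    (hθ : θ ∈ Set.Ioo 0 Real.pi) :
    ∫ t in (0 : ℝ)..2 * Real.log ξ, peterssonIntegrand k F (hyperbolicPower k ξ m) (expPoint t θ) =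
      b m * ((Real.exp (-(Real.pi * (m + m) * θ / Real.log ξ)) * Real.sin θ ^ k : ℝ) : ℂ) *
        (2 * Real.log ξ) := by
  set c : ℤ → ℝ := fun l ↦ Real.exp (-(Real.pi * (l + m) * θ / Real.log ξ)) * Real.sin θ ^ k with hc
  set u : ℤ → ℝ → ℂ := fun l t ↦ Complex.exp (Complex.I * (Real.pi * (l - m) / Real.log ξ) * t) with hu
  have hsum : ∀ t : ℝ, HasSum (fun l ↦ b l * c l * u l t)
      (peterssonIntegrand k F (hyperbolicPower k ξ m) (expPoint t θ)) := by
    intro t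
    have := ((hb (expPoint t θ)).mul_right ((starRingEnd ℂ) (hyperbolicPower k ξ m
      (expPoint t θ)))).mul_right (((expPoint t θ).im : ℂ) ^ k)
    refine this.congr_fun fun l ↦ ?_
    rw [mul_assoc, ← hyperbolicPower_mul_conj_expPoint k ξ l m hθ]
    ring
  have hu1 : ∀ l t, ‖u l t‖ = 1 := by
    intro l t
    rw [hu]
    have : Complex.I * (Real.pi * (l - m) / Real.log ξ) * t =
      ((Real.pi * (l - m) / Real.log ξ * t : ℝ) : ℂ) * Complex.I := by push_cast; ring
    simp only [this, Complex.norm_exp_ofReal_mul_I]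
  have hs : Summable fun l ↦ ‖b l * c l‖ := by
    have := (hsum 0).summable.norm
    refine this.congr fun l ↦ ?_
    rw [norm_mul _ (u l 0), hu1, mul_one]
  have key := intervalIntegral.hasSum_integral_of_dominated_convergence (μ := volume) (a := 0)
    (b := 2 * Real.log ξ) (F := fun l t ↦ b l * c l * u l t)
    (f := fun t ↦ peterssonIntegrand k F (hyperbolicPower k ξ m) (expPoint t θ))
    (fun l _ ↦ ‖b l * c l‖) (fun l ↦ (by fun_prop : Continuous _).aestronglyMeasurable)
    (fun l ↦ Filter.Eventually.of_forall fun t _ ↦ by rw [norm_mul _ (u l t), hu1, mul_one])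
    (Filter.Eventually.of_forall fun _ _ ↦ hs) intervalIntegrable_const
    (Filter.Eventually.of_forall fun t _ ↦ hsum t)
  have hI : ∀ l, ∫ t in (0 : ℝ)..2 * Real.log ξ, b l * c l * u l t =
      if l = m then b m * c m * (2 * Real.log ξ) else 0 := by
    intro l
    rw [intervalIntegral.integral_const_mul, hu, integral_exp_eq_ite hξ]
    split_ifs with h
    · rw [h]
    · rw [mul_zero]
  simp only [hI] at key
  exact key.unique (hasSum_ite_eq m _)

theorem integral_halfAnnulus_peterssonIntegrand (hξ : 1 < ξ) (hk : 2 ≤ k)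
    (hb : ∀ w, HasSum (fun l ↦ b l * hyperbolicPower k ξ l w) (F w)) (m : ℤ)
    (hint : IntegrableOn (peterssonIntegrand k F (hyperbolicPower k ξ m)) (halfAnnulus ξ)) :
    ∫ w in halfAnnulus ξ, peterssonIntegrand k F (hyperbolicPower k ξ m) w =
      b m * ((2 * Real.log ξ * ∫ θ in (0 : ℝ)..Real.pi,
        Real.exp (-2 * Real.pi * m * θ / Real.log ξ) * Real.sin θ ^ (k - 2) : ℝ) : ℂ) := by
  have hlog := Real.log_pos hξ
  obtain ⟨h1, h2⟩ := integrableOn_and_setIntegral_halfAnnulus hξ hint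
  rw [← h2]
  rw [IntegrableOn] at h1
  rw [Measure.volume_eq_prod, ← Measure.prod_restrict] at h1 ⊢
  rw [integral_prod_symm _ h1]
  have key : Set.EqOn (fun θ : ℝ ↦ ∫ t in Set.Ico 0 (2 * Real.log ξ), (Real.sin θ ^ 2)⁻¹ •
      peterssonIntegrand k F (hyperbolicPower k ξ m) (expPoint t θ))
      (fun θ : ℝ ↦ b m * (2 * Real.log ξ) *
        ((Real.exp (-2 * Real.pi * m * θ / Real.log ξ) * Real.sin θ ^ (k - 2) : ℝ) : ℂ))
      (Set.Ioo 0 Real.pi) := by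
    intro θ hθ
    have hsin := (Real.sin_pos_of_mem_Ioo hθ).ne'
    simp only
    rw [integral_smul, integral_Ico_eq_integral_Ioc,
      ← intervalIntegral.integral_of_le (by linarith),
      integral_peterssonIntegrand_expPoint hξ hb m hθ]
    have hexp : -(Real.pi * (m + m) * θ / Real.log ξ) = -2 * Real.pi * m * θ / Real.log ξ := by ring
    have hpow : Real.sin θ ^ k = Real.sin θ ^ (k - 2) * Real.sin θ ^ 2 := by
      rw [← pow_add]; congr 1; omega
    rw [hexp, hpow, Complex.real_smul]
    have hsin' : (Real.sin θ : ℂ) ≠ 0 := by exact_mod_cast hsin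
    push_cast at hsin' ⊢
    field_simp
  rw [setIntegral_congr_fun measurableSet_Ioo key, integral_const_mul, integral_complex_ofReal,
    ← integral_Ioc_eq_integral_Ioo, ← intervalIntegral.integral_of_le Real.pi_pos.le]
  push_cast
  ring

end

/-! ### Evaluation of the integral over the angle -/

theorem integral_exp_mul_sin_pow_add_two (a : ℝ) (n : ℕ) :
    (4 * a ^ 2 + (n + 2) ^ 2) *
      ∫ θ in (0 : ℝ)..Real.pi, Real.exp (-(2 * a * θ)) * Real.sin θ ^ (n + 2) =
      (n + 2) * (n + 1) * ∫ θ in (0 : ℝ)..Real.pi, Real.exp (-(2 * a * θ)) * Real.sin θ ^ n := by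
  -- Two integrations by parts condensed into one antiderivative, which vanishes at `0` and `π`
  -- because of the powers of `sin θ`.
  have hderiv : ∀ θ : ℝ, HasDerivAt (fun θ ↦ Real.exp (-(2 * a * θ)) *
      (-(2 * a * Real.sin θ ^ (n + 2)) - (n + 2) * (Real.sin θ ^ (n + 1) * Real.cos θ)))
      ((4 * a ^ 2 + (n + 2) ^ 2) * (Real.exp (-(2 * a * θ)) * Real.sin θ ^ (n + 2)) -
        (n + 2) * (n + 1) * (Real.exp (-(2 * a * θ)) * Real.sin θ ^ n)) θ := by
    intro θ
    have h1 : HasDerivAt (fun θ ↦ Real.exp (-(2 * a * θ)))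
        (Real.exp (-(2 * a * θ)) * -(2 * a * 1)) θ :=
      (((hasDerivAt_id θ).const_mul (2 * a)).neg).exp
    have h2 := ((Real.hasDerivAt_sin θ).pow (n + 2)).const_mul (2 * a)
    have h3 := (((Real.hasDerivAt_sin θ).pow (n + 1)).mul (Real.hasDerivAt_cos θ)).const_mul
      ((n : ℝ) + 2)
    refine (h1.mul (h2.neg.sub h3)).congr_deriv ?_
    have hc : Real.cos θ ^ 2 = 1 - Real.sin θ ^ 2 := Real.cos_sq' θ
    simp only [Nat.add_sub_cancel, show n + 2 - 1 = n + 1 by omega, Pi.neg_apply, Pi.sub_apply,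
      Pi.mul_apply, Pi.pow_apply]
    push_cast
    linear_combination (-(n + 2) * (n + 1) * Real.exp (-(2 * a * θ)) * Real.sin θ ^ n) * hc
  have h := intervalIntegral.integral_eq_sub_of_hasDerivAt (a := 0) (b := Real.pi)
    (fun θ _ ↦ hderiv θ) ((by fun_prop : Continuous _).intervalIntegrable _ _)
  rw [intervalIntegral.integral_sub ((by fun_prop : Continuous _).intervalIntegrable _ _)
    ((by fun_prop : Continuous _).intervalIntegrable _ _), intervalIntegral.integral_const_mul,
    intervalIntegral.integral_const_mul] at h
  simp at h
  linarith

theorem integral_exp_mul_sin_pow_two_mul_zero (j : ℕ) :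
    ∫ θ in (0 : ℝ)..Real.pi, Real.exp (-(2 * 0 * θ)) * Real.sin θ ^ (2 * j) =
      Real.pi / 2 ^ (2 * j) * ((2 * j).choose j : ℝ) := by
  induction j with
  | zero => simp
  | succ j ih =>
    have h := integral_exp_mul_sin_pow_add_two 0 (2 * j)
    rw [ih] at h
    have hb := Nat.succ_mul_centralBinom_succ j
    simp only [Nat.centralBinom] at hb
    have hb' : ((j : ℝ) + 1) * ((2 * (j + 1)).choose (j + 1) : ℝ) =
      2 * (2 * j + 1) * ((2 * j).choose j : ℝ) := by exact_mod_cast hb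
    have hj : (j : ℝ) + 1 ≠ 0 := by positivity
    have h4 : (2 * (j : ℝ) + 2) ^ 2 ≠ 0 := by positivity
    rw [show 2 * (j + 1) = 2 * j + 2 by ring] at hb' ⊢
    push_cast at h
    apply mul_left_cancel₀ h4
    rw [show (4 * (0 : ℝ) ^ 2 + (2 * j + 2) ^ 2) = (2 * j + 2) ^ 2 by ring] at h
    have hC : ((2 * j + 2).choose (j + 1) : ℝ) =
        2 * (2 * j + 1) * ((2 * j).choose j : ℝ) / (j + 1) := by
      rw [eq_div_iff hj, mul_comm, hb']
    rw [h, pow_add, hC]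
    field_simp

/-- Induction by the recursion. The Gamma quotient satisfies it too, by `Γ(s + 1) = s Γ(s)`; for `a
≠ 0` none of the arguments is a pole. -/
theorem integral_exp_mul_sin_pow_two_mul {a : ℝ} (ha : a ≠ 0) (j : ℕ) :
    ((∫ θ in (0 : ℝ)..Real.pi, Real.exp (-(2 * a * θ)) * Real.sin θ ^ (2 * j) : ℝ) : ℂ) =
      1 / (2 * Complex.I) ^ (2 * j + 1) * (Complex.exp (-(2 * Real.pi * a)) - 1) *
        (Complex.Gamma (a * Complex.I - j) * Complex.Gamma (2 * j + 1) /
          Complex.Gamma (a * Complex.I + j + 1)) := by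
  have ha' : (a : ℂ) ≠ 0 := by exact_mod_cast ha
  have hne : ∀ x : ℝ, (x : ℂ) + a * Complex.I ≠ 0 := by
    intro x h
    have := congrArg Complex.im h
    simp at this
    exact ha this
  induction j with
  | zero =>
    have h1 : ∫ θ in (0 : ℝ)..Real.pi, Real.exp (-(2 * a * θ)) * Real.sin θ ^ (2 * 0) =
        (1 - Real.exp (-(2 * Real.pi * a))) / (2 * a) := by
      simp only [mul_zero, pow_zero, mul_one, ← neg_mul]
      rw [intervalIntegral.integral_comp_mul_left (fun x ↦ Real.exp x) (by simpa using ha),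
        integral_exp, smul_eq_mul, mul_zero, Real.exp_zero,
        show -2 * a * Real.pi = -2 * Real.pi * a by ring]
      field_simp
      ring
    have h0 : a * Complex.I ≠ 0 := mul_ne_zero ha' Complex.I_ne_zero
    have hG : Complex.Gamma (a * Complex.I) ≠ 0 := by
      refine Complex.Gamma_ne_zero fun n hn ↦ hne n ?_
      rw [hn]; simp
    rw [h1]
    simp only [Nat.cast_zero, sub_zero, add_zero, mul_zero, zero_add, pow_one, Complex.Gamma_one]
    rw [Complex.Gamma_add_one _ h0]
    push_cast
    have := Complex.I_sq
    field_simp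
    linear_combination (1 - Complex.exp (-(2 * Real.pi * a))) * this
  | succ j ih =>
    have h := congrArg Complex.ofReal (integral_exp_mul_sin_pow_add_two a (2 * j))
    rw [Complex.ofReal_mul, Complex.ofReal_mul _ (intervalIntegral _ _ _ _), ih] at h
    have e1 : Complex.Gamma (a * Complex.I - j) =
        (a * Complex.I - (j + 1)) * Complex.Gamma (a * Complex.I - (j + 1)) := by
      have := hne (-(j + 1))
      rw [← Complex.Gamma_add_one]
      · congr 1; ring
      · push_cast at this
        intro h0; apply this; rw [← h0]; ring
    have e2 : Complex.Gamma (a * Complex.I + (j + 1) + 1) =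
        (a * Complex.I + (j + 1)) * Complex.Gamma (a * Complex.I + j + 1) := by
      have := hne (j + 1)
      rw [Complex.Gamma_add_one, add_assoc _ (j : ℂ)]
      push_cast at this
      intro h0; apply this; rw [← h0]; ring
    have e3 : Complex.Gamma (2 * (j + 1) + 1) =
        (2 * j + 2) * (2 * j + 1) * Complex.Gamma (2 * j + 1) := by
      rw [show (2 * ((j : ℂ) + 1) + 1) = (2 * j + 1 + 1) + 1 by ring, Complex.Gamma_add_one,
        Complex.Gamma_add_one]
      · ring
      · exact_mod_cast (2 * j).succ_ne_zero
      · exact_mod_cast (2 * j + 1).succ_ne_zero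
    -- The coefficient of the recursion splits into the two shifts of the Gamma arguments; the
    -- factor `-4` is `(2 i) ^ 2`.
    have e4 : (4 * a ^ 2 + (2 * j + 2) ^ 2 : ℂ) =
        -4 * ((a * Complex.I - (j + 1)) * (a * Complex.I + (j + 1))) := by
      linear_combination (4 * a ^ 2 : ℂ) * Complex.I_sq
    have hm : (a * Complex.I - (j + 1) : ℂ) ≠ 0 := by
      have := hne (-(j + 1))
      push_cast at this
      intro h0; apply this; rw [← h0]; ring
    have hp : (a * Complex.I + (j + 1) : ℂ) ≠ 0 := by
      have := hne (j + 1)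
      push_cast at this
      intro h0; apply this; rw [← h0]; ring
    have hpow : (2 * Complex.I) ^ (2 * (j + 1) + 1) = -4 * (2 * Complex.I) ^ (2 * j + 1) := by
      rw [show 2 * (j + 1) + 1 = 2 + (2 * j + 1) by ring, pow_add, mul_pow, Complex.I_sq]
      ring
    have h4 : (4 * a ^ 2 + (2 * j + 2) ^ 2 : ℂ) ≠ 0 := by
      rw [e4]
      exact mul_ne_zero (by norm_num) (mul_ne_zero hm hp)
    push_cast at h ⊢
    rw [show 2 * (j + 1) = 2 * j + 2 by ring] at hpow ⊢
    apply mul_left_cancel₀ h4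
    rw [h, e1, e2, e3, e4, hpow]
    have hI : (2 * Complex.I) ^ (2 * j + 1) ≠ 0 := pow_ne_zero _ (by simp)
    generalize Complex.Gamma (a * Complex.I + j + 1) = G
    generalize Complex.Gamma (a * Complex.I - (j + 1)) = G'
    generalize a * Complex.I - ((j : ℂ) + 1) = x at hm ⊢
    generalize a * Complex.I + ((j : ℂ) + 1) = y at hp ⊢
    field_simp

end

/-! ### The inner product formula -/

theorem proposition8
    (Γ : Subgroup (GL (Fin 2) ℝ)) [Γ.HasDetOne] [DiscreteTopology Γ]
    (D : Set ℍ) (hD : IsFundamentalDomain (transformationGroup Γ) D) (hV : volume D < ⊤)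
    (η₁ η₂ : OnePoint ℝ) (hη : IsHyperbolicPair Γ η₁ η₂)
    (γη σ : GL (Fin 2) ℝ) (ξ : ℝ) (hσ : IsHyperbolicScaling Γ η₁ η₂ γη σ ξ)
    (k : ℕ) (hk : 4 ≤ k) (hk_even : Even k) (m : ℤ)
    (f : CuspForm Γ k) (b : ℤ → ℂ) (hb : IsHyperbolicExpansion k σ ξ f b) :
    (∀ z : ℍ, Summable fun q : RightCosets Γ (pairStabilizer Γ η₁ η₂) ↦
      relPoincareTerm Γ (pairStabilizer Γ η₁ η₂) k (hyperbolicSeed k σ ξ m) q z) ∧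
    IntegrableOn (peterssonIntegrand k f (hyperbolicPoincare Γ η₁ η₂ k σ ξ m)) D ∧
    peterssonInner k D f (hyperbolicPoincare Γ η₁ η₂ k σ ξ m) =
      b m * ((2 * Real.log ξ *
        ∫ θ in (0 : ℝ)..Real.pi,
          Real.exp (-2 * Real.pi * m * θ / Real.log ξ) * Real.sin θ ^ (k - 2) : ℝ) : ℂ) ∧
    (m ≠ 0 →
      peterssonInner k D f (hyperbolicPoincare Γ η₁ η₂ k σ ξ m) =
        b m * (2 * Real.log ξ / (2 * Complex.I) ^ (k - 1) *
          (Complex.exp (-2 * Real.pi ^ 2 * m / Real.log ξ) - 1) *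
          (Complex.Gamma (Real.pi * Complex.I * m / Real.log ξ - k / 2 + 1) *
              Complex.Gamma (k - 1) /
            Complex.Gamma (Real.pi * Complex.I * m / Real.log ξ + k / 2)))) ∧
    (m = 0 →
      peterssonInner k D f (hyperbolicPoincare Γ η₁ η₂ k σ ξ m) =
        b 0 * (2 * Real.pi * Real.log ξ / 2 ^ (k - 2) * ((k - 2).choose (k / 2 - 1) : ℂ))) := by
  obtain ⟨hint, hint', hinner⟩ := integrableOn_and_peterssonInner_eq hD hσ hk hk_even m hV f
  have hmain := hinner.trans
    (integral_halfAnnulus_peterssonIntegrand hσ.one_lt (by omega) hb m hint')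
  -- The exponent `k - 2` becomes `2 * j`, as in the evaluated integrals, where `a = π m / log ξ`.
  obtain ⟨j, rfl⟩ : ∃ j, k = 2 * j + 2 := by
    obtain ⟨i, rfl⟩ := hk_even
    exact ⟨i - 1, by omega⟩
  have hlog := (Real.log_pos hσ.one_lt).ne'
  have hexp : ∀ θ : ℝ, Real.exp (-2 * Real.pi * m * θ / Real.log ξ) =
      Real.exp (-(2 * (Real.pi * m / Real.log ξ) * θ)) := fun θ ↦ by congr 1; ring
  refine ⟨fun z ↦ (summable_norm_relPoincareTerm hD hσ hk hk_even m z).of_norm, hint, hmain,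
    fun hm ↦ ?_, ?_⟩
  · have hI := integral_exp_mul_sin_pow_two_mul
      (div_ne_zero (mul_ne_zero Real.pi_ne_zero (Int.cast_ne_zero.mpr hm)) hlog) j
    rw [hmain]
    simp only [hexp, Nat.add_sub_cancel]
    rw [Complex.ofReal_mul, hI, show 2 * j + 2 - 1 = 2 * j + 1 by omega]
    have e1 : (Real.pi * Complex.I * m / Real.log ξ - ((2 * j + 2 : ℕ) : ℂ) / 2 + 1 : ℂ) =
        ((Real.pi * m / Real.log ξ : ℝ) : ℂ) * Complex.I - j := by push_cast; ring
    have e2 : (Real.pi * Complex.I * m / Real.log ξ + ((2 * j + 2 : ℕ) : ℂ) / 2 : ℂ) =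
        ((Real.pi * m / Real.log ξ : ℝ) : ℂ) * Complex.I + j + 1 := by push_cast; ring
    have e3 : (((2 * j + 2 : ℕ) : ℂ) - 1) = 2 * j + 1 := by push_cast; ring
    have e4 : (-2 * Real.pi ^ 2 * m / Real.log ξ : ℂ) =
        -(2 * Real.pi * ((Real.pi * m / Real.log ξ : ℝ) : ℂ)) := by push_cast; ring
    rw [e1, e2, e3, e4]
    push_cast
    ring
  · rintro rfl
    rw [hmain]
    simp only [hexp, Nat.add_sub_cancel]
    simp only [Int.cast_zero, mul_zero, zero_div]
    have hI := integral_exp_mul_sin_pow_two_mul_zero j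
    simp only [mul_zero] at hI
    rw [hI, show (2 * j + 2) / 2 - 1 = j by omega]
    push_cast
    ring
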